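/- Let $V\in L^1_{\rm loc}(\mathbb R)$ be real-valued, $\mathcal A=-\frac{d^2}{dx^2}+V$, let $-\infty<a_-<a_+<\infty$, and put $I_-=(-\infty,a_-]$, $I=[a_-,a_+]$, $I_+=[a_+,\infty)$. Let $A_\pm^*$ be the maximal operator of $\mathcal A$ in $L^2(I_\pm)$, whose domain consists of all $f\in L^2(I_\pm)$ such that $f,f'$ are locally absolutely continuous on $I_\pm$ and $\mathcal A f\in L^2(I_\pm)$. Assume that $\mathcal A$ is in the limit point case at $+\infty$ and at $-\infty$, i.e. $\dim\ker(A_\pm^*-i)=\dim\ker(A_\pm^*+i)=1$. Let $H$ be the operator $H\psi=\mathcal A\psi$ in $L^2(\mathbb R)$ whose domain consists of all $\psi\in L^2(\mathbb R)$ such that $\psi,\psi'$ are locally absolutely continuous and $\mathcal A\psi\in L^2(\mathbb R)$; let $\rho(H)$ be its resolvent set. For $\lambda\in\mathbb C\setminus\mathbb R$ let $c_\pm(\lambda,\cdot),s_\pm(\lambda,\cdot)$ be the solutions of $\mathcal A f=\lambda f$ on $I_\pm$ with $c_\pm(\lambda,a_\pm)=s_\pm'(\lambda,a_\pm)=1$,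 $c_\pm'(\lambda,a_\pm)=s_\pm(\lambda,a_\pm)=0$, and let the Weyl--Titchmarsh coefficient $m_\pm(\lambda)$ be the number for which $c_\pm(\lambda,\cdot)\pm m_\pm(\lambda)s_\pm(\lambda,\cdot)\in L^2(I_\pm)$. At a real point $\lambda\in\rho(H)$ the symbol $m_\pm$ denotes the meromorphic extension of this function to a neighbourhood of $\lambda$ (which exists). Let $\lambda\in\rho(H)$, $g\in L^2(I)$, let $\widetilde g\in L^2(\mathbb R)$ be the extension of $g$ by zero, and $\psi=(H-\lambda)^{-1}\widetilde g$. Then the restriction $\varphi$ of $\psi$ to $I$ is the unique function $\varphi\in L^2(I)$ with $\varphi,\varphi'$ absolutely continuous on $I$ that solves $$(\mathcal A-\lambda)\varphi=g\quad\text{a.e. on } I,$$ $$\varphi'(a_-)+m_-(\lambda)\varphi(a_-)=0,\qquad \varphi'(a_+)-m_+(\lambda)\varphi(a_+)=0,$$ where the condition at $a_-$ (resp. $a_+$) is understood as $\varphi(a_-)=0$ (resp. $\varphi(a_+)=0$) if $\lambda$ is a pole of $m_-$ (resp. $m_+$). In other words, $\varphi=P_{L^2(I)}(H-\lambda)^{-1}\widetilde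 g$, where $P_{L^2(I)}$ is the orthogonal projection in $L^2(\mathbb R)$ onto $L^2(I)$ (identified with its image under extension by zero). -/

import Mathlib

open MeasureTheory Set Filter Topology

namespace Schrodinger

/-! ### The differential expression `𝒜 = -d²/dx² + V` on an interval `S` -/

/-- `f` is locally absolutely continuous on the interval `S`: absolutely continuous on every
compact interval with endpoints in `S`. -/
def LocAC (f : ℝ → ℂ) (S : Set ℝ) : Prop :=
  ∀ x ∈ S, ∀ y ∈ S, AbsolutelyContinuousOnInterval f x y

/-- `u` is differentiable on `S`, and `u`, `u'` are locally absolutely continuous on `S`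
(one-sided derivatives at the endpoints of `S` that belong to `S`). -/
structure Reg (u : ℝ → ℂ) (S : Set ℝ) : Prop where
  diff : DifferentiableOn ℝ u S
  ac : LocAC u S
  ac_deriv : LocAC (derivWithin u S) S

/-- `(𝒜 u)(x) = -u''(x) + V(x) u(x)` on the interval `S` (for `u` with `Reg u S` the second
derivative exists for almost every `x ∈ S`). -/
noncomputable def diffExpr (V : ℝ → ℝ) (S : Set ℝ) (u : ℝ → ℂ) (x : ℝ) : ℂ :=
  -derivWithin (derivWithin u S) S x + (V x : ℂ) * u x

/-- The complex Hilbert space `L²(S)` for `S ⊆ ℝ` with Lebesgue measure. -/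
abbrev L2 (S : Set ℝ) : Type := Lp ℂ 2 (volume.restrict S)

/-! ### Helper facts -/

theorem LocAC.add {f g : ℝ → ℂ} {S : Set ℝ} (hf : LocAC f S) (hg : LocAC g S) :
    LocAC (f + g) S := fun x hx y hy => (hf x hx y hy).add (hg x hx y hy)

theorem LocAC.const_smul {f : ℝ → ℂ} {S : Set ℝ} (c : ℂ) (hf : LocAC f S) :
    LocAC (c • f) S := fun x hx y hy => (hf x hx y hy).const_smul c

theorem LocAC.congr {f g : ℝ → ℂ} {S : Set ℝ} [hS : S.OrdConnected] (hf : LocAC f S)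
    (h : EqOn f g S) : LocAC g S := by
  intro x hx y hy
  have h1 := hf x hx y hy
  have hsub : uIcc x y ⊆ S := hS.uIcc_subset hx hy
  rw [absolutelyContinuousOnInterval_iff] at h1 ⊢
  intro ε hε
  obtain ⟨δ, hδ, H⟩ := h1 ε hε
  refine ⟨δ, hδ, fun E hE hlt => ?_⟩
  have := H E hE hlt
  rw [AbsolutelyContinuousOnInterval.disjWithin, mem_ofPred_eq] at hE
  refine lt_of_eq_of_lt (Finset.sum_congr rfl fun i hi => ?_) this
  have := hE.1 i hi
  rw [h (hsub this.1), h (hsub this.2)]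

theorem LocAC.ae_diff {f : ℝ → ℂ} {S : Set ℝ} [hS : S.OrdConnected] (hf : LocAC f S) :
    ∀ᵐ x ∂volume.restrict S, DifferentiableWithinAt ℝ f S x := by
  have h : LocallyBoundedVariationOn f S := fun a b ha hb =>
    (hf a ha b hb).boundedVariationOn.mono
      (inter_subset_right.trans Icc_subset_uIcc)
  exact h.ae_differentiableWithinAt hS.measurableSet

theorem Reg.zero (S : Set ℝ) : Reg 0 S := by
  have h : LocAC (0 : ℝ → ℂ) S := by
    intro x _ y _
    have : AbsolutelyContinuousOnInterval (fun _ : ℝ => (0 : ℂ)) x y :=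
      (LipschitzWith.const (0 : ℂ)).lipschitzOnWith.absolutelyContinuousOnInterval
    exact this
  have e : derivWithin (0 : ℝ → ℂ) S = 0 := derivWithin_zero S
  exact ⟨differentiableOn_const 0, h, by rw [e]; exact h⟩

theorem Reg.add {u v : ℝ → ℂ} {S : Set ℝ} [S.OrdConnected] (hu : Reg u S) (hv : Reg v S) :
    Reg (u + v) S :=
  ⟨hu.diff.add hv.diff, hu.ac.add hv.ac, (hu.ac_deriv.add hv.ac_deriv).congr fun x hx =>
    (derivWithin_add (hu.diff x hx) (hv.diff x hx)).symm⟩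

theorem Reg.const_smul {u : ℝ → ℂ} {S : Set ℝ} [S.OrdConnected] (c : ℂ) (hu : Reg u S) :
    Reg (c • u) S :=
  ⟨hu.diff.const_smul c, hu.ac.const_smul c, (hu.ac_deriv.const_smul c).congr fun x hx =>
    (derivWithin_const_smul c (hu.diff x hx)).symm⟩

theorem diffExpr_add (V : ℝ → ℝ) {u v : ℝ → ℂ} {S : Set ℝ} [hS : S.OrdConnected]
    (hu : Reg u S) (hv : Reg v S) :
    diffExpr V S (u + v) =ᵐ[volume.restrict S] diffExpr V S u + diffExpr V S v := by
  filter_upwards [hu.ac_deriv.ae_diff, hv.ac_deriv.ae_diff,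
    ae_restrict_mem hS.measurableSet] with x h1 h2 hx
  have e : EqOn (derivWithin (u + v) S) (derivWithin u S + derivWithin v S) S := fun y hy =>
    derivWithin_add (hu.diff y hy) (hv.diff y hy)
  simp only [diffExpr, Pi.add_apply]
  rw [derivWithin_congr e (e hx), derivWithin_add h1 h2]
  ring

theorem diffExpr_const_smul (V : ℝ → ℝ) {u : ℝ → ℂ} {S : Set ℝ} [hS : S.OrdConnected]
    (c : ℂ) (hu : Reg u S) :
    diffExpr V S (c • u) =ᵐ[volume.restrict S] c • diffExpr V S u := by
  filter_upwards [hu.ac_deriv.ae_diff, ae_restrict_mem hS.measurableSet] with x h1 hx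
  have e : EqOn (derivWithin (c • u) S) (c • derivWithin u S) S := fun y hy =>
    derivWithin_const_smul c (hu.diff y hy)
  simp only [diffExpr, Pi.smul_apply, smul_eq_mul]
  rw [derivWithin_congr e (e hx), derivWithin_const_smul c h1, smul_eq_mul]
  ring

theorem diffExpr_zero (V : ℝ → ℝ) (S : Set ℝ) : diffExpr V S 0 = 0 := by
  funext x
  have e : derivWithin (0 : ℝ → ℂ) S = 0 := derivWithin_zero S
  simp [diffExpr, e]

/-! ### The maximal operator on `L²(S)` and defect spaces -/

/-- The graph of the maximal operator of `𝒜` in `L²(S)`: all pairs `(u, 𝒜 u)` with `u` and `𝒜 u`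
in `L²(S)` and `u`, `u'` locally absolutely continuous on `S`. -/
def maxGraph (V : ℝ → ℝ) (S : Set ℝ) [S.OrdConnected] : Submodule ℂ (L2 S × L2 S) where
  carrier := {p | ∃ u : ℝ → ℂ, Reg u S ∧ p.1 =ᵐ[volume.restrict S] u ∧
    p.2 =ᵐ[volume.restrict S] diffExpr V S u}
  zero_mem' := ⟨0, Reg.zero S, Lp.coeFn_zero _ _ _, by
    rw [diffExpr_zero]; exact Lp.coeFn_zero _ _ _⟩
  add_mem' := by
    rintro ⟨f, f'⟩ ⟨g, g'⟩ ⟨u, hu, h1, h2⟩ ⟨v, hv, h3, h4⟩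
    exact ⟨u + v, hu.add hv, (Lp.coeFn_add f g).trans (h1.add h3),
      (Lp.coeFn_add f' g').trans ((h2.add h4).trans (diffExpr_add V hu hv).symm)⟩
  smul_mem' := by
    rintro c ⟨f, f'⟩ ⟨u, hu, h1, h2⟩
    exact ⟨c • u, hu.const_smul c, (Lp.coeFn_smul c f).trans (h1.const_smul c),
      (Lp.coeFn_smul c f').trans ((h2.const_smul c).trans (diffExpr_const_smul V c hu).symm)⟩

/-- The maximal operator of `𝒜` in `L²(S)`, as an unbounded operator. On a half-line
`S = [a, ∞)` or `S = (-∞, a]` it is the adjoint `A_±^*` of the minimal operator `A_±`. -/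
noncomputable def maxOp (V : ℝ → ℝ) (S : Set ℝ) [S.OrdConnected] : L2 S →ₗ.[ℂ] L2 S :=
  (maxGraph V S).toLinearPMap

/-- On an interval with non-empty interior, `𝒜 u` depends only on the class of `u`, so that the
graph of `maxOp V S` is `maxGraph V S`. -/
theorem graph_maxOp (V : ℝ → ℝ) (S : Set ℝ) [hS : S.OrdConnected] (hi : (interior S).Nonempty) :
    (maxOp V S).graph = maxGraph V S := by
  refine Submodule.toLinearPMap_graph_eq _ ?_
  rintro ⟨f, f'⟩ ⟨u, hu, h1, h2⟩ (h0 : f = 0)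
  subst h0
  have hz : u =ᵐ[volume.restrict S] 0 := h1.symm.trans (Lp.coeFn_zero _ _ _)
  have hcl : S ⊆ closure (interior S) := by
    rw [(convex_iff_ordConnected.2 hS).closure_interior_eq_closure_of_nonempty_interior hi]
    exact subset_closure
  have e : EqOn u 0 S :=
    Measure.eqOn_of_ae_eq hz hu.diff.continuousOn continuousOn_const hcl
  have e1 : EqOn (derivWithin u S) 0 S := fun x hx => by
    rw [derivWithin_congr e (e hx)]
    simp
  have e2 : diffExpr V S u =ᵐ[volume.restrict S] 0 := by
    filter_upwards [ae_restrict_mem hS.measurableSet] with x hx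
    simp only [diffExpr]
    rw [derivWithin_congr e1 (e1 hx), e hx]
    simp
  exact Lp.ext (h2.trans (e2.trans (Lp.coeFn_zero _ _ _).symm))

/-- The defect space `ker (A^* - z)`, with `A^*` the maximal operator of `𝒜` in `L²(S)`. -/
noncomputable def defectSpace (V : ℝ → ℝ) (S : Set ℝ) [S.OrdConnected] (z : ℂ) : Submodule ℂ (L2 S) :=
  (maxGraph V S).comap (LinearMap.prod LinearMap.id (z • LinearMap.id))

/-- Limit point case on the half-line `S` (at its infinite end): both defect numbers
`dim ker (A^* - i)` and `dim ker (A^* + i)` are equal to `1`. -/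
def LimitPoint (V : ℝ → ℝ) (S : Set ℝ) [S.OrdConnected] : Prop :=
  Module.finrank ℂ (defectSpace V S Complex.I) = 1 ∧
    Module.finrank ℂ (defectSpace V S (-Complex.I)) = 1

/-! ### The operator `H` on the whole line and its resolvent -/

/-- The operator `H` generated by `𝒜` in `L²(ℝ)`: its domain consists of all `ψ ∈ L²(ℝ)` such
that `ψ`, `ψ'` are locally absolutely continuous and `𝒜 ψ ∈ L²(ℝ)`. -/
noncomputable def hamiltonian (V : ℝ → ℝ) : L2 univ →ₗ.[ℂ] L2 univ := maxOp V univ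

/-- `R` is the bounded, everywhere defined inverse of `T - z`. -/
def IsResolventAt {E : Type*} [NormedAddCommGroup E] [NormedSpace ℂ E] (T : E →ₗ.[ℂ] E) (z : ℂ)
    (R : E →L[ℂ] E) : Prop :=
  (∀ g : E, ∃ h : R g ∈ T.domain, T ⟨R g, h⟩ - z • R g = g) ∧
    ∀ f : T.domain, R (T f - z • (f : E)) = f

/-- The inverse of `T - z` is unique. -/
theorem IsResolventAt.unique {E : Type*} [NormedAddCommGroup E] [NormedSpace ℂ E]
    {T : E →ₗ.[ℂ] E} {z : ℂ} {R R' : E →L[ℂ] E} (h : IsResolventAt T z R)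
    (h' : IsResolventAt T z R') : R = R' := by
  ext g
  obtain ⟨hd, he⟩ := h'.1 g
  have := h.2 ⟨R' g, hd⟩
  rw [he] at this
  exact this

/-- The resolvent set `ρ(T)` of an unbounded operator `T`. -/
def rho {E : Type*} [NormedAddCommGroup E] [NormedSpace ℂ E] (T : E →ₗ.[ℂ] E) : Set ℂ :=
  {z | ∃ R : E →L[ℂ] E, IsResolventAt T z R}

open Classical in
/-- The resolvent `(T - z)⁻¹` (for `z ∈ ρ(T)`; zero otherwise). -/
noncomputable def resolventOp {E : Type*} [NormedAddCommGroup E] [NormedSpace ℂ E]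
    (T : E →ₗ.[ℂ] E) (z : ℂ) : E →L[ℂ] E :=
  if h : ∃ R : E →L[ℂ] E, IsResolventAt T z R then h.choose else 0

/-! ### Restriction to `S`, extension by zero, and the projection onto `L²(S)` -/

theorem memLp_restrict {S : Set ℝ} (f : L2 univ) : MemLp f 2 (volume.restrict S) :=
  (Lp.memLp f).mono_measure (Measure.restrict_mono (subset_univ S) le_rfl)

/-- The restriction to `S` of an element of `L²(ℝ)`. -/
noncomputable def restrictTo (S : Set ℝ) (f : L2 univ) : L2 S := (memLp_restrict f).toLp f

theorem memLp_indicator (S : Set ℝ) [hS : S.OrdConnected] (g : L2 S) :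
    MemLp (S.indicator g) 2 (volume.restrict univ) := by
  rw [Measure.restrict_univ, memLp_indicator_iff_restrict hS.measurableSet]
  exact Lp.memLp g

/-- The extension by zero `g ↦ g ⊕ 0`, an isometry from `L²(S)` into `L²(ℝ)`. -/
noncomputable def zeroExt (S : Set ℝ) [hS : S.OrdConnected] : L2 S →ₗᵢ[ℂ] L2 univ where
  toFun g := (memLp_indicator S g).toLp (S.indicator g)
  map_add' f g := by
    rw [← MemLp.toLp_add, MemLp.toLp_eq_toLp_iff, ← indicator_add', Measure.restrict_univ]
    exact (ae_eq_restrict_iff_indicator_ae_eq hS.measurableSet).1 (Lp.coeFn_add f g)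
  map_smul' c g := by
    have e : c • S.indicator (g : ℝ → ℂ) = S.indicator (c • (g : ℝ → ℂ)) :=
      (indicator_const_smul S c (g : ℝ → ℂ)).symm
    rw [RingHom.id_apply, ← MemLp.toLp_const_smul, MemLp.toLp_eq_toLp_iff, e,
      Measure.restrict_univ]
    exact (ae_eq_restrict_iff_indicator_ae_eq hS.measurableSet).1 (Lp.coeFn_smul c g)
  norm_map' g := by
    change ‖(memLp_indicator S g).toLp (S.indicator g)‖ = ‖g‖
    rw [Lp.norm_toLp, Lp.norm_def, Measure.restrict_univ,
      eLpNorm_indicator_eq_eLpNorm_restrict hS.measurableSet]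

/-- `L²(S)` as a closed subspace of `L²(ℝ)`, through extension by zero. -/
noncomputable def L2Sub (S : Set ℝ) [S.OrdConnected] : Submodule ℂ (L2 univ) :=
  LinearMap.range (zeroExt S).toLinearMap

instance (S : Set ℝ) [S.OrdConnected] : CompleteSpace (L2Sub S) :=
  ((zeroExt S).isometry.isUniformInducing.isComplete_range).completeSpace_coe

/-! ### Weyl-Titchmarsh coefficients -/

/-- `u` solves `𝒜 u = z u` on `S`. -/
def IsEigenSol (V : ℝ → ℝ) (S : Set ℝ) (z : ℂ) (u : ℝ → ℂ) : Prop :=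
  Reg u S ∧ diffExpr V S u =ᵐ[volume.restrict S] fun x => z * u x

/-- For the half-line `S` with endpoint `a`, and the sign `σ` (`1` for `S = [a, ∞)`, `-1` for
`S = (-∞, a]`): the number `m` has the property that `c + σ m s ∈ L²(S)`, where `c`, `s` are the
solutions of `𝒜 u = z u` on `S` with `c(a) = s'(a) = 1`, `c'(a) = s(a) = 0`. -/
def IsWeylCoeff (V : ℝ → ℝ) (S : Set ℝ) (a : ℝ) (σ : ℂ) (z m : ℂ) : Prop :=
  ∃ c s : ℝ → ℂ, IsEigenSol V S z c ∧ IsEigenSol V S z s ∧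
    c a = 1 ∧ derivWithin c S a = 0 ∧ s a = 0 ∧ derivWithin s S a = 1 ∧
    MemLp (fun x => c x + σ * m * s x) 2 (volume.restrict S)

open Classical in
/-- The Weyl-Titchmarsh coefficient at a non-real point `z`. -/
noncomputable def weylCoeff (V : ℝ → ℝ) (S : Set ℝ) (a : ℝ) (σ : ℂ) (z : ℂ) : ℂ :=
  if h : ∃ m, IsWeylCoeff V S a σ z m then h.choose else 0

/-- `m_+` on `ℂ \ ℝ`, for the half-line `[a, ∞)`. -/
noncomputable def weylPlus (V : ℝ → ℝ) (a : ℝ) : ℂ → ℂ := weylCoeff V (Ici a) a 1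

/-- `m_-` on `ℂ \ ℝ`, for the half-line `(-∞, a]`. -/
noncomputable def weylMinus (V : ℝ → ℝ) (a : ℝ) : ℂ → ℂ := weylCoeff V (Iic a) a (-1)

/-- `M` is, near `z₀`, the meromorphic extension of the function `m` on `ℂ \ ℝ` (normalized, so
that `M` is analytic at `z₀` unless `z₀` is a pole). The germ of `M` at `z₀` is unique. -/
def IsMeromorphicExtAt (m M : ℂ → ℂ) (z₀ : ℂ) : Prop :=
  MeromorphicNFAt M z₀ ∧ ∀ᶠ z in 𝓝 z₀, z.im ≠ 0 → M z = m z

/-- The boundary condition `v - τ(z) u = 0`, where `τ = σ m` and `m` is extended meromorphically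
to `z`; if `z` is a pole of the extension, it is understood as `u = 0`. -/
def WeylBC (m : ℂ → ℂ) (σ z u v : ℂ) : Prop :=
  ∃ M : ℂ → ℂ, IsMeromorphicExtAt m M z ∧
    (0 ≤ meromorphicOrderAt M z → v - σ * M z * u = 0) ∧
    (meromorphicOrderAt M z < 0 → u = 0)

/-- `φ ∈ L²(I)`, `I = [a₋, a₊]`, is a solution of `(𝒜 - z) φ = g` on `I` subject to
`φ'(a₋) + m_-(z) φ(a₋) = 0` and `φ'(a₊) - m_+(z) φ(a₊) = 0`. -/
def IsTBCSolution (V : ℝ → ℝ) (am ap : ℝ) (z : ℂ) (g φ : L2 (Icc am ap)) : Prop :=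
  ∃ u : ℝ → ℂ, φ =ᵐ[volume.restrict (Icc am ap)] u ∧ Reg u (Icc am ap) ∧
    (∀ᵐ x ∂volume.restrict (Icc am ap), diffExpr V (Icc am ap) u x - z * u x = g x) ∧
    WeylBC (weylMinus V am) (-1) z (u am) (derivWithin u (Icc am ap) am) ∧
    WeylBC (weylPlus V ap) 1 z (u ap) (derivWithin u (Icc am ap) ap)

end Schrodinger

namespace Schrodinger

/-! ### Absolutely continuous functions with values in a normed space -/

/-! For a point `a`, let D₊(z) and D₋(z) be the subspaces of ℂ² formed by the data (u(a), u'(a)) of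
the solutions of 𝒜u = zu that are square integrable at +∞ and at -∞ respectively (`weylSpace`).
Suppose that φ solves (𝒜 - z)φ = g on I, with data in D₋(z) at a₋ and in D₊(z) at a₊. Continued to ℝ
with the source g extended by zero, φ is square integrable on both tails, so it lies in the domain
of H and equals the resolvent applied to that source. Conversely, the resolvent applied to the
extended source solves the homogeneous equation outside I and is square integrable, so its data at
a₋ and a₊ lie in these spaces. The theorem therefore reduces to `weylBC_iff`: the Weyl–Titchmarsh
boundary condition at z, pole or not, says exactly that the data lie in D₊(z) or D₋(z).

At non-real points, σm is the slope of the line D. To reach real points of ρ(H), D needs a spanning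
vector p(z) that is analytic and non-zero near z₀. Then σm = p₂/p₁ is meromorphic with a pole
exactly where p₁ vanishes, and in both cases the boundary condition is det(p(z₀), data) = 0.

The vector p comes from the projection P(z) of ℂ² onto D₊(z) along D₋(z), which is built from the
resolvent (`exists_analytic_projection`). The data of a function at a point are bounded in the graph
norm (`exists_clm_data`) and the resolvent is analytic, hence so is P. Since z is not an eigenvalue,
D₊ ∩ D₋ = 0 (`disjoint_weylSpace`). For non-real z both spaces are non-trivial by Weyl's compactness
argument (`exists_weyl_sol_aux`). Near z₀ both are therefore lines at non-real points, so P has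
trace 1 there. By continuity it has trace 1 at z₀ as well, and neither P(z₀) nor 1 - P(z₀) vanishes
(`exists_analytic_data`).

As V is only locally integrable, all of this rests on the integral form of the first order system
for (u, u'), solved by Picard iteration. -/

theorem AC.of_dist_le {X Y : Type*} [PseudoMetricSpace X] [PseudoMetricSpace Y] {F : ℝ → X}
    {G : ℝ → Y} {a b : ℝ} (hG : AbsolutelyContinuousOnInterval G a b)
    (h : ∀ x ∈ uIcc a b, ∀ y ∈ uIcc a b, dist (F x) (F y) ≤ dist (G x) (G y)) :
    AbsolutelyContinuousOnInterval F a b := by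
  rw [absolutelyContinuousOnInterval_iff] at hG ⊢
  intro ε hε
  obtain ⟨δ, hδ, H⟩ := hG ε hε
  refine ⟨δ, hδ, fun E hE hlt => lt_of_le_of_lt ?_ (H E hE hlt)⟩
  rw [AbsolutelyContinuousOnInterval.disjWithin, mem_ofPred_eq] at hE
  exact Finset.sum_le_sum fun i hi => h _ (hE.1 i hi).1 _ (hE.1 i hi).2

theorem ae_ne (a : ℝ) : ∀ᵐ t : ℝ, t ≠ a := by simp [ae_iff, measure_singleton]

theorem intervalIntegrable_of_locallyIntegrable {E : Type*} [NormedAddCommGroup E] {f : ℝ → E}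
    (hf : LocallyIntegrable f) (x y : ℝ) : IntervalIntegrable f volume x y :=
  intervalIntegrable_iff.mpr <|
    (hf.integrableOn_isCompact isCompact_uIcc).mono_set uIoc_subset_uIcc

/-- The increments of the primitive of f are dominated by those of the primitive of ‖f‖, which
reduces the claim to the scalar case. -/
theorem AC.integral {E : Type*} [NormedAddCommGroup E] [NormedSpace ℝ E] {f : ℝ → E} {a b c : ℝ}
    (hf : IntervalIntegrable f volume a b) (hc : c ∈ uIcc a b) :
    AbsolutelyContinuousOnInterval (fun x => ∫ t in c..x, f t) a b := by
  refine AC.of_dist_le (hf.norm.absolutelyContinuousOnInterval_intervalIntegral hc) ?_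
  intro x hx y hy
  have h1 : ∀ z ∈ uIcc a b, IntervalIntegrable f volume c z := fun z hz =>
    hf.mono_set (uIcc_subset_uIcc hc hz)
  rw [dist_eq_norm, Real.dist_eq, intervalIntegral.integral_interval_sub_left (h1 x hx) (h1 y hy),
    intervalIntegral.integral_interval_sub_left (h1 x hx).norm (h1 y hy).norm]
  exact intervalIntegral.norm_integral_le_abs_integral_norm

theorem intervalIntegrable_ofReal {f : ℝ → ℝ} {a b : ℝ} (hf : IntervalIntegrable f volume a b) :
    IntervalIntegrable (fun t => (f t : ℂ)) volume a b := by
  rw [intervalIntegrable_iff] at hf ⊢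
  exact hf.ofReal

theorem locallyIntegrable_norm {E : Type*} [NormedAddCommGroup E] {f : ℝ → E}
    (hf : LocallyIntegrable f) : LocallyIntegrable fun t => ‖f t‖ := by
  rw [locallyIntegrable_iff] at hf ⊢
  exact fun K hK => (hf K hK).norm

theorem AC.integral_eq_sub_real {F w : ℝ → ℝ} {a b : ℝ}
    (hF : AbsolutelyContinuousOnInterval F a b)
    (hd : ∀ᵐ t, t ∈ uIoc a b → HasDerivAt F (w t) t) :
    IntervalIntegrable w volume a b ∧ ∫ t in a..b, w t = F b - F a := by
  have e : ∀ᵐ t, t ∈ uIoc a b → deriv F t = w t := by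
    filter_upwards [hd] with t ht h using (ht h).deriv
  refine ⟨hF.intervalIntegrable_deriv.congr_ae ((ae_restrict_iff' measurableSet_uIoc).2 e), ?_⟩
  rw [← intervalIntegral.integral_congr_ae e, hF.integral_deriv_eq_sub]

/-- The fundamental theorem of calculus for complex-valued absolutely continuous functions. -/
theorem AC.integral_eq_sub {F w : ℝ → ℂ} {a b : ℝ}
    (hF : AbsolutelyContinuousOnInterval F a b)
    (hd : ∀ᵐ t, t ∈ uIoc a b → HasDerivAt F (w t) t) :
    IntervalIntegrable w volume a b ∧ ∫ t in a..b, w t = F b - F a := by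
  have hre : AbsolutelyContinuousOnInterval (fun t => (F t).re) a b :=
    AC.of_dist_le hF fun x _ y _ => by
      rw [dist_eq_norm, dist_eq_norm, ← Complex.sub_re]; exact Complex.abs_re_le_norm _
  have him : AbsolutelyContinuousOnInterval (fun t => (F t).im) a b :=
    AC.of_dist_le hF fun x _ y _ => by
      rw [dist_eq_norm, dist_eq_norm, ← Complex.sub_im]; exact Complex.abs_im_le_norm _
  obtain ⟨i1, e1⟩ := AC.integral_eq_sub_real (w := fun t => (w t).re) hre (by
    filter_upwards [hd] with t ht h
    exact (Complex.reCLM.hasFDerivAt.comp_hasDerivAt t (ht h)))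
  obtain ⟨i2, e2⟩ := AC.integral_eq_sub_real (w := fun t => (w t).im) him (by
    filter_upwards [hd] with t ht h
    exact (Complex.imCLM.hasFDerivAt.comp_hasDerivAt t (ht h)))
  have hw : w = fun t => ((w t).re : ℂ) + ((w t).im : ℂ) * Complex.I := by
    funext t; exact (Complex.re_add_im _).symm
  have j1 : IntervalIntegrable (fun t => ((w t).re : ℂ)) volume a b :=
    intervalIntegrable_ofReal i1
  have j2 : IntervalIntegrable (fun t => ((w t).im : ℂ) * Complex.I) volume a b :=
    IntervalIntegrable.mul_const (intervalIntegrable_ofReal i2) _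
  refine ⟨by rw [hw]; exact j1.add j2, ?_⟩
  rw [hw, intervalIntegral.integral_add j1 j2, intervalIntegral.integral_mul_const,
    intervalIntegral.integral_ofReal, intervalIntegral.integral_ofReal, e1, e2]
  apply Complex.ext <;> simp

/-- The power κⁿ⁺¹ of the primitive κ of k is absolutely continuous with derivative (n + 1) k κⁿ
almost everywhere. This produces the factorials in the Picard bounds although k is merely
integrable. -/
theorem integral_mul_pow_primitive {k : ℝ → ℝ} (hk : LocallyIntegrable k) (a x : ℝ) (n : ℕ) :
    IntervalIntegrable (fun t => k t * (∫ s in a..t, k s) ^ n) volume a x ∧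
    ∫ t in a..x, k t * (∫ s in a..t, k s) ^ n = (∫ s in a..x, k s) ^ (n + 1) / (n + 1) := by
  have hac : AbsolutelyContinuousOnInterval (fun t => ∫ s in a..t, k s) a x :=
    AC.integral (intervalIntegrable_of_locallyIntegrable hk a x) left_mem_uIcc
  have hpow : ∀ m : ℕ,
      AbsolutelyContinuousOnInterval (fun t => (∫ s in a..t, k s) ^ (m + 1)) a x := by
    intro m
    induction m with
    | zero => simpa using hac
    | succ m ih =>
      simp only [pow_succ _ (m + 1)]
      exact ih.fun_mul hac
  have := AC.integral_eq_sub_real (w := fun t => (n + 1) * (k t * (∫ s in a..t, k s) ^ n))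
    (hpow n) (by
      filter_upwards [LocallyIntegrable.ae_hasDerivAt_integral hk] with t ht _
      have := (ht a).pow (n + 1)
      convert! this using 1
      push_cast [Nat.add_sub_cancel]
      ring)
  obtain ⟨h1, h2⟩ := this
  have hn : (n + 1 : ℝ) ≠ 0 := by positivity
  constructor
  · have := h1.const_mul (n + 1 : ℝ)⁻¹
    simpa [← mul_assoc, inv_mul_cancel₀ hn] using this
  · rw [intervalIntegral.integral_const_mul] at h2
    rw [eq_div_iff hn, mul_comm, h2]
    simp

/-! ### Linear systems `y' = A y` with locally integrable coefficients -/

section Volterra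

variable {E : Type*} [NormedAddCommGroup E] [NormedSpace ℝ E]

theorem intervalIntegrable_clm_apply {A : ℝ → E →L[ℝ] E} (hA : LocallyIntegrable A)
    {w : ℝ → E} {a b : ℝ} (hw : ContinuousOn w (uIcc a b)) :
    IntervalIntegrable (fun t => A t (w t)) volume a b := by
  obtain ⟨C, hC⟩ := isCompact_uIcc.exists_bound_of_continuousOn hw
  have hA' := intervalIntegrable_of_locallyIntegrable hA a b
  have hm := (ContinuousLinearMap.id ℝ (E →L[ℝ] E)).aestronglyMeasurable_comp₂
    hA'.aestronglyMeasurable_restrict_uIoc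
    ((hw.mono uIoc_subset_uIcc).aestronglyMeasurable measurableSet_uIoc)
  refine (hA'.norm.mul_const C).mono_fun hm ?_
  refine (ae_restrict_iff' measurableSet_uIoc).2 (.of_forall fun t ht => ?_)
  have hCt := hC t (uIoc_subset_uIcc ht)
  have : 0 ≤ C := (norm_nonneg _).trans hCt
  calc ‖A t (w t)‖ ≤ ‖A t‖ * ‖w t‖ := (A t).le_opNorm _
    _ ≤ ‖A t‖ * C := by gcongr
    _ = ‖‖A t‖ * C‖ := by simp [abs_of_nonneg this]

/-- One step of the iteration raises the power of ∫‖A‖ by one and divides by n + 1. Repeated, it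
gives the bound C κⁿ/n!, which yields both uniqueness and convergence of the Picard series. -/
theorem norm_volterra_le {A : ℝ → E →L[ℝ] E} (hA : LocallyIntegrable A) {w : ℝ → E} {a x C : ℝ}
    (n : ℕ) (hw : ∀ t ∈ uIcc a x, ‖w t‖ ≤ C * |∫ s in a..t, ‖A s‖| ^ n / n.factorial) :
    ‖∫ t in a..x, A t (w t)‖ ≤ C * |∫ s in a..x, ‖A s‖| ^ (n + 1) / (n + 1).factorial := by
  set κ : ℝ → ℝ := fun t => ∫ s in a..t, ‖A s‖ with hκ
  have hC : 0 ≤ C * |κ a| ^ n / n.factorial := (norm_nonneg _).trans (hw a left_mem_uIcc)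
  -- The primitive κ has a constant sign s between a and x (negative to the left of a), so |κ|ⁿ = sⁿ
  -- κⁿ there and the bound can be integrated exactly.
  obtain ⟨s, hs, hs'⟩ : ∃ s : ℝ, |s| = 1 ∧ ∀ t ∈ uIcc a x, |κ t| = s * κ t := by
    rcases le_total a x with h | h
    · refine ⟨1, by simp, fun t ht => ?_⟩
      rw [uIcc_of_le h] at ht
      rw [one_mul, abs_of_nonneg]
      exact intervalIntegral.integral_nonneg ht.1 fun _ _ => norm_nonneg _
    · refine ⟨-1, by simp, fun t ht => ?_⟩
      rw [uIcc_of_ge h] at ht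
      rw [neg_one_mul, abs_of_nonpos]
      simp only [hκ]
      rw [intervalIntegral.integral_symm, neg_nonpos]
      exact intervalIntegral.integral_nonneg ht.2 fun _ _ => norm_nonneg _
  obtain ⟨i, e⟩ := integral_mul_pow_primitive (locallyIntegrable_norm hA) a x n
  have hfac : (0 : ℝ) < n.factorial := by positivity
  have key := intervalIntegral.norm_integral_le_abs_of_norm_le (μ := volume) (a := a) (b := x)
    (f := fun t => A t (w t)) (g := fun t => (C / n.factorial * s ^ n) * (‖A t‖ * κ t ^ n)) ?_
    (i.const_mul _)
  · refine key.trans (le_of_eq ?_)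
    rw [intervalIntegral.integral_const_mul, e]
    have hC' : 0 ≤ C * |κ x| ^ n := by
      have := (norm_nonneg _).trans (hw x right_mem_uIcc)
      rwa [le_div_iff₀ hfac, zero_mul] at this
    rw [abs_mul, abs_mul, abs_div, abs_div, abs_pow, abs_pow, hs, one_pow, mul_one,
      abs_of_pos hfac, Nat.factorial_succ, pow_succ |κ x|]
    have h1 : |((n : ℝ) + 1)| = n + 1 := abs_of_nonneg (by positivity)
    rw [h1]
    push_cast
    have : |C| * |κ x| ^ n = C * |κ x| ^ n := by
      rw [← abs_of_nonneg hC', abs_mul, abs_pow, abs_abs]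
    field_simp
    linear_combination |κ x| * this
  · refine (ae_restrict_iff' measurableSet_uIoc).2 (.of_forall fun t ht => ?_)
    have ht' := uIoc_subset_uIcc ht
    calc ‖A t (w t)‖ ≤ ‖A t‖ * ‖w t‖ := (A t).le_opNorm _
      _ ≤ ‖A t‖ * (C * |κ t| ^ n / n.factorial) := by gcongr; exact hw t ht'
      _ = _ := by rw [hs' t ht', mul_pow]; ring

/-- A continuous solution of `y = ∫ A y` vanishes. -/
theorem volterra_unique {A : ℝ → E →L[ℝ] E} (hA : LocallyIntegrable A) {w : ℝ → E} {a b : ℝ}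
    (hw : ContinuousOn w (uIcc a b)) (h : ∀ x ∈ uIcc a b, w x = ∫ t in a..x, A t (w t)) :
    ∀ x ∈ uIcc a b, w x = 0 := by
  obtain ⟨C, hC⟩ := isCompact_uIcc.exists_bound_of_continuousOn hw
  have bound : ∀ n : ℕ, ∀ x ∈ uIcc a b,
      ‖w x‖ ≤ C * |∫ s in a..x, ‖A s‖| ^ n / n.factorial := by
    intro n
    induction n with
    | zero => simpa using hC
    | succ n ih =>
      intro x hx
      rw [h x hx]
      exact norm_volterra_le hA n fun t ht => ih t (uIcc_subset_uIcc_left hx ht)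
  intro x hx
  have lim : Tendsto (fun n : ℕ => C * |∫ s in a..x, ‖A s‖| ^ n / n.factorial) atTop (𝓝 0) := by
    have := (FloorSemiring.tendsto_pow_div_factorial_atTop |∫ s in a..x, ‖A s‖|).const_mul C
    simpa [mul_div_assoc] using this
  exact norm_le_zero_iff.1 (ge_of_tendsto' lim fun n => bound n x hx)

/-- The Picard iterates of `y ↦ ∫ A y`. -/
noncomputable def picard (A : ℝ → E →L[ℝ] E) (a : ℝ) (y₀ : ℝ → E) : ℕ → ℝ → E
  | 0 => y₀
  | n + 1 => fun x => ∫ t in a..x, A t (picard A a y₀ n t)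

theorem continuous_picard {A : ℝ → E →L[ℝ] E} (hA : LocallyIntegrable A) (a : ℝ) {y₀ : ℝ → E}
    (h₀ : Continuous y₀) (n : ℕ) : Continuous (picard A a y₀ n) := by
  induction n with
  | zero => exact h₀
  | succ n ih =>
    exact intervalIntegral.continuous_primitive
      (fun x y => intervalIntegrable_clm_apply hA ih.continuousOn) a

/-- The solution is the sum of the Picard iterates. The factorial bound makes the series uniformly
convergent on every interval with endpoint a, and dominated convergence moves the sum through the
integral. -/
theorem volterra_exists [CompleteSpace E] {A : ℝ → E →L[ℝ] E} (hA : LocallyIntegrable A) (a : ℝ) {y₀ : ℝ → E}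
    (h₀ : Continuous y₀) :
    ∃ y : ℝ → E, Continuous y ∧ ∀ x, y x = y₀ x + ∫ t in a..x, A t (y t) := by
  set p := picard A a y₀ with hp
  have hbound : ∀ b : ℝ, ∃ u : ℕ → ℝ, Summable u ∧ ∀ n, ∀ x ∈ uIcc a b, ‖p n x‖ ≤ u n := by
    intro b
    obtain ⟨C, hC⟩ := isCompact_uIcc.exists_bound_of_continuousOn
      (s := uIcc a b) h₀.continuousOn
    have hC0 : 0 ≤ C := (norm_nonneg _).trans (hC a left_mem_uIcc)
    have bound : ∀ n : ℕ, ∀ x ∈ uIcc a b,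
        ‖p n x‖ ≤ C * |∫ s in a..x, ‖A s‖| ^ n / n.factorial := by
      intro n
      induction n with
      | zero => simpa [hp, picard] using hC
      | succ n ih =>
        intro x hx
        exact norm_volterra_le hA n fun t ht => ih t (uIcc_subset_uIcc_left hx ht)
    refine ⟨fun n => C * (|∫ s in a..b, ‖A s‖| ^ n / n.factorial),
      (Real.summable_pow_div_factorial _).mul_left C, fun n x hx => (bound n x hx).trans ?_⟩
    rw [mul_div_assoc]
    refine mul_le_mul_of_nonneg_left (div_le_div_of_nonneg_right
      (pow_le_pow_left₀ (abs_nonneg _) ?_ n) (by positivity)) hC0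
    exact intervalIntegral.abs_integral_mono_interval
      (uIoc_subset_uIoc_of_uIcc_subset_uIcc (uIcc_subset_uIcc_left hx))
      (.of_forall fun _ => norm_nonneg _)
      (intervalIntegrable_of_locallyIntegrable hA a b).norm
  have hcont : ∀ b, ContinuousOn (fun x => ∑' n, p n x) (uIcc a b) := by
    intro b
    obtain ⟨u, hu, hub⟩ := hbound b
    exact continuousOn_tsum (fun n => (continuous_picard hA a h₀ n).continuousOn) hu hub
  refine ⟨fun x => ∑' n, p n x, ?_, fun x => ?_⟩
  · rw [continuous_iff_continuousAt]
    intro x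
    rcases le_total a x with h | h
    -- Uniform convergence is available on intervals starting at a. At a itself the continuity is
    -- glued from the two sides.
    · by_cases hax : a = x
      · subst hax
        have h1 := (hcont (a + 1)) a left_mem_uIcc
        have h2 := (hcont (a - 1)) a left_mem_uIcc
        rw [continuousAt_iff_continuous_left_right]
        rw [uIcc_of_le (by linarith)] at h1
        rw [uIcc_of_ge (by linarith)] at h2
        exact ⟨(continuousWithinAt_Icc_iff_Iic (by linarith)).1 h2,
          (continuousWithinAt_Icc_iff_Ici (by linarith)).1 h1⟩
      · refine (hcont (x + 1)).continuousAt ?_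
        rw [uIcc_of_le (by linarith)]
        exact Icc_mem_nhds (lt_of_le_of_ne h hax) (by linarith)
    · by_cases hax : a = x
      · subst hax
        have h1 := (hcont (a + 1)) a left_mem_uIcc
        have h2 := (hcont (a - 1)) a left_mem_uIcc
        rw [continuousAt_iff_continuous_left_right]
        rw [uIcc_of_le (by linarith)] at h1
        rw [uIcc_of_ge (by linarith)] at h2
        exact ⟨(continuousWithinAt_Icc_iff_Iic (by linarith)).1 h2,
          (continuousWithinAt_Icc_iff_Ici (by linarith)).1 h1⟩
      · refine (hcont (x - 1)).continuousAt ?_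
        rw [uIcc_of_ge (by linarith)]
        exact Icc_mem_nhds (by linarith) (lt_of_le_of_ne h (Ne.symm hax))
  · obtain ⟨u, hu, hub⟩ := hbound x
    have hsum : ∀ t ∈ uIcc a x, Summable fun n => p n t := fun t ht =>
      Summable.of_norm_bounded hu fun n => hub n t ht
    have key : HasSum (fun n => ∫ t in a..x, A t (p n t)) (∫ t in a..x, A t (∑' n, p n t)) := by
      refine intervalIntegral.hasSum_integral_of_dominated_convergence
        (fun n t => ‖A t‖ * u n) (fun n => ?_) (fun n => ?_) ?_ ?_ ?_
      · exact (intervalIntegrable_clm_apply hA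
          (continuous_picard hA a h₀ n).continuousOn).aestronglyMeasurable_restrict_uIoc
      · refine .of_forall fun t ht => ((A t).le_opNorm _).trans ?_
        gcongr
        exact hub n t (uIoc_subset_uIcc ht)
      · exact .of_forall fun t _ => hu.mul_left _
      · simp_rw [tsum_mul_left]
        exact (intervalIntegrable_of_locallyIntegrable hA a x).norm.mul_const _
      · exact .of_forall fun t ht => (A t).hasSum (hsum t (uIoc_subset_uIcc ht)).hasSum
    have h2 := (hsum x right_mem_uIcc).tsum_eq_zero_add
    beta_reduce
    rw [h2, ← key.tsum_eq]
    rfl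

end Volterra

/-! ### The equation `-u'' + q u = h` in integral form -/

/-- The potential `V - z`. -/
noncomputable def pot (V : ℝ → ℝ) (z : ℂ) (t : ℝ) : ℂ := (V t : ℂ) - z

theorem locallyIntegrable_pot {V : ℝ → ℝ} (hV : LocallyIntegrable V) (z : ℂ) :
    LocallyIntegrable (pot V z) := by
  have h1 : LocallyIntegrable fun t => (V t : ℂ) := by
    rw [locallyIntegrable_iff] at hV ⊢
    exact fun K hK => (hV K hK).ofReal
  exact h1.sub (continuous_const (y := z)).locallyIntegrable

/-- `u' = v` and `v' = q u - h` on `S`, in integral form. -/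
structure IsSol (q h : ℝ → ℂ) (S : Set ℝ) (u v : ℝ → ℂ) : Prop where
  cont_u : ContinuousOn u S
  cont_v : ContinuousOn v S
  eq_u : ∀ x ∈ S, ∀ y ∈ S, u y - u x = ∫ t in x..y, v t
  eq_v : ∀ x ∈ S, ∀ y ∈ S, v y - v x = ∫ t in x..y, (q t * u t - h t)

theorem ae_uIoc_of_ae_restrict {S : Set ℝ} [hS : S.OrdConnected] {p : ℝ → Prop}
    (h : ∀ᵐ t ∂volume.restrict S, p t) {x y : ℝ} (hx : x ∈ S) (hy : y ∈ S) :
    ∀ᵐ t, t ∈ uIoc x y → p t := by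
  filter_upwards [(ae_restrict_iff' hS.measurableSet).1 h] with t ht h'
  exact ht (hS.uIcc_subset hx hy (uIoc_subset_uIcc h'))

namespace IsSol

variable {q h k : ℝ → ℂ} {S T : Set ℝ} {u v f w : ℝ → ℂ}

theorem mono (H : IsSol q h S u v) (hT : T ⊆ S) : IsSol q h T u v :=
  ⟨H.cont_u.mono hT, H.cont_v.mono hT, fun x hx y hy => H.eq_u x (hT hx) y (hT hy),
    fun x hx y hy => H.eq_v x (hT hx) y (hT hy)⟩

/-- Only the combination q u - h matters. A multiple of u can thus be moved between potential and
source, which is how the spectral parameter is changed below. -/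
theorem congr_coeff [S.OrdConnected] {q' h' : ℝ → ℂ} (H : IsSol q h S u v)
    (e : ∀ᵐ t ∂volume.restrict S, q' t * u t - h' t = q t * u t - h t) : IsSol q' h' S u v :=
  ⟨H.cont_u, H.cont_v, H.eq_u, fun x hx y hy => by
    rw [H.eq_v x hx y hy]
    refine intervalIntegral.integral_congr_ae ?_
    filter_upwards [ae_uIoc_of_ae_restrict e hx hy] with t ht h using (ht h).symm⟩

theorem congr_source [S.OrdConnected] {h' : ℝ → ℂ} (H : IsSol q h S u v)
    (e : ∀ᵐ t ∂volume.restrict S, h' t = h t) : IsSol q h' S u v :=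
  H.congr_coeff (by filter_upwards [e] with t ht; rw [ht])

theorem intervalIntegrable_v [hS : S.OrdConnected] (H : IsSol q h S u v) {x y : ℝ} (hx : x ∈ S)
    (hy : y ∈ S) : IntervalIntegrable v volume x y :=
  (H.cont_v.mono (hS.uIcc_subset hx hy)).intervalIntegrable

theorem intervalIntegrable_rhs [hS : S.OrdConnected] (H : IsSol q h S u v)
    (hq : LocallyIntegrable q) (hh : LocallyIntegrable h) {x y : ℝ} (hx : x ∈ S) (hy : y ∈ S) :
    IntervalIntegrable (fun t => q t * u t - h t) volume x y :=
  ((intervalIntegrable_of_locallyIntegrable hq x y).mul_continuousOn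
    (H.cont_u.mono (hS.uIcc_subset hx hy))).sub (intervalIntegrable_of_locallyIntegrable hh x y)

theorem add [S.OrdConnected] (H : IsSol q h S u v) (K : IsSol q k S f w)
    (hq : LocallyIntegrable q) (hh : LocallyIntegrable h) (hk : LocallyIntegrable k) :
    IsSol q (h + k) S (u + f) (v + w) := by
  refine ⟨H.cont_u.add K.cont_u, H.cont_v.add K.cont_v, fun x hx y hy => ?_, fun x hx y hy => ?_⟩
  · simp only [Pi.add_apply]
    rw [intervalIntegral.integral_add (H.intervalIntegrable_v hx hy) (K.intervalIntegrable_v hx hy),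
      ← H.eq_u x hx y hy, ← K.eq_u x hx y hy]
    ring
  · have := intervalIntegral.integral_add (H.intervalIntegrable_rhs hq hh hx hy)
      (K.intervalIntegrable_rhs hq hk hx hy)
    rw [← H.eq_v x hx y hy, ← K.eq_v x hx y hy] at this
    simp only [Pi.add_apply]
    rw [add_sub_add_comm, ← this]
    congr 1
    funext t
    ring

theorem smul (c : ℂ) (H : IsSol q h S u v) : IsSol q (c • h) S (c • u) (c • v) := by
  refine ⟨H.cont_u.const_smul c, H.cont_v.const_smul c, fun x hx y hy => ?_, fun x hx y hy => ?_⟩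
  · simp only [Pi.smul_apply]
    rw [intervalIntegral.integral_smul, ← smul_sub, H.eq_u x hx y hy]
  · simp only [Pi.smul_apply]
    rw [← smul_sub, H.eq_v x hx y hy, ← intervalIntegral.integral_smul]
    congr 1
    funext t
    simp only [smul_eq_mul]
    ring

theorem sub [S.OrdConnected] (H : IsSol q h S u v) (K : IsSol q k S f w)
    (hq : LocallyIntegrable q) (hh : LocallyIntegrable h) (hk : LocallyIntegrable k) :
    IsSol q (h - k) S (u - f) (v - w) := by
  have := H.add (K.smul (-1)) hq hh (hk.smul (-1))
  simpa [sub_eq_add_neg] using this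

theorem conj (H : IsSol q h S u v) :
    IsSol (fun t => starRingEnd ℂ (q t)) (fun t => starRingEnd ℂ (h t)) S
      (fun t => starRingEnd ℂ (u t)) (fun t => starRingEnd ℂ (v t)) := by
  have hi : ∀ (g : ℝ → ℂ) (x y : ℝ),
      ∫ t in x..y, starRingEnd ℂ (g t) = starRingEnd ℂ (∫ t in x..y, g t) := fun g x y => by
    rw [intervalIntegral, intervalIntegral, map_sub, integral_conj, integral_conj]
  refine ⟨Complex.continuous_conj.comp_continuousOn H.cont_u,
    Complex.continuous_conj.comp_continuousOn H.cont_v, fun x hx y hy => ?_, fun x hx y hy => ?_⟩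
  · rw [hi, ← map_sub, H.eq_u x hx y hy]
  · rw [← map_sub, H.eq_v x hx y hy, ← hi]
    simp

end IsSol

/-! ### The initial value problem: existence, uniqueness, continuation to the line -/

section IVP

variable {q h k : ℝ → ℂ} {S T : Set ℝ} {u v f w : ℝ → ℂ}

/-- The matrix of the first order system equivalent to `u'' = q u`. -/
noncomputable def sysMatrix (q : ℝ → ℂ) (t : ℝ) : ℂ × ℂ →L[ℝ] ℂ × ℂ :=
  (ContinuousLinearMap.inl ℝ ℂ ℂ).comp (ContinuousLinearMap.snd ℝ ℂ ℂ) +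
    (ContinuousLinearMap.inr ℝ ℂ ℂ).comp
      ((ContinuousLinearMap.mul ℝ ℂ (q t)).comp (ContinuousLinearMap.fst ℝ ℂ ℂ))

theorem sysMatrix_apply (q : ℝ → ℂ) (t : ℝ) (y : ℂ × ℂ) :
    sysMatrix q t y = (y.2, q t * y.1) := by
  simp [sysMatrix]

theorem integrable_add_of_normed {α E : Type*} [MeasurableSpace α] [NormedAddCommGroup E]
    {μ : Measure α} {f g : α → E} (hf : Integrable f μ) (hg : Integrable g μ) :
    Integrable (fun x => f x + g x) μ := hf.add hg

theorem locallyIntegrable_sysMatrix (hq : LocallyIntegrable q) :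
    LocallyIntegrable (sysMatrix q) := by
  rw [locallyIntegrable_iff] at hq ⊢
  intro K hK
  have h1 : IntegrableOn (fun _ : ℝ =>
      (ContinuousLinearMap.inl ℝ ℂ ℂ).comp (ContinuousLinearMap.snd ℝ ℂ ℂ)) K :=
    continuous_const.locallyIntegrable.integrableOn_isCompact hK
  have h2 : IntegrableOn (fun t => (ContinuousLinearMap.inr ℝ ℂ ℂ).comp
      ((ContinuousLinearMap.mul ℝ ℂ (q t)).comp (ContinuousLinearMap.fst ℝ ℂ ℂ))) K := by
    let L : ℂ →L[ℝ] (ℂ × ℂ →L[ℝ] ℂ × ℂ) :=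
      (ContinuousLinearMap.compL ℝ (ℂ × ℂ) ℂ (ℂ × ℂ) (ContinuousLinearMap.inr ℝ ℂ ℂ)).comp
      (((ContinuousLinearMap.compL ℝ (ℂ × ℂ) ℂ ℂ).flip (ContinuousLinearMap.fst ℝ ℂ ℂ)).comp
        (ContinuousLinearMap.mul ℝ ℂ))
    exact L.integrable_comp (hq K hK)
  exact integrable_add_of_normed h1 h2

theorem integral_prod_mk {f g : ℝ → ℂ} {a b : ℝ} (hf : IntervalIntegrable f volume a b)
    (hg : IntervalIntegrable g volume a b) :
    ∫ t in a..b, (f t, g t) = (∫ t in a..b, f t, ∫ t in a..b, g t) := by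
  simp only [intervalIntegral]
  rw [integral_pair hf.1 hg.1, integral_pair hf.2 hg.2]
  rfl

theorem IsSol.eq_zero [hS : S.OrdConnected] (hq : LocallyIntegrable q) (H : IsSol q 0 S u v)
    {a : ℝ} (ha : a ∈ S) (hu : u a = 0) (hv : v a = 0) : ∀ x ∈ S, u x = 0 ∧ v x = 0 := by
  intro b hb
  have hsub := hS.uIcc_subset ha hb
  have := volterra_unique (locallyIntegrable_sysMatrix hq) (w := fun t => (u t, v t)) (a := a)
    (b := b) ((H.cont_u.mono hsub).prodMk (H.cont_v.mono hsub)) (fun x hx => by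
      simp only [sysMatrix_apply]
      have i1 := H.intervalIntegrable_v ha (hsub hx)
      have i2 := H.intervalIntegrable_rhs hq locallyIntegrable_zero ha (hsub hx)
      have e1 := H.eq_u a ha x (hsub hx)
      have e2 := H.eq_v a ha x (hsub hx)
      simp only [Pi.zero_apply, sub_zero] at i2 e2
      rw [integral_prod_mk i1 i2, ← e1, ← e2, hu, hv, sub_zero, sub_zero]) b right_mem_uIcc
  exact Prod.mk_eq_zero.1 this

theorem IsSol.unique [hS : S.OrdConnected] (hq : LocallyIntegrable q) (hh : LocallyIntegrable h)
    (H : IsSol q h S u v) (K : IsSol q h S f w)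
    {a : ℝ} (ha : a ∈ S) (hu : u a = f a) (hv : v a = w a) :
    ∀ x ∈ S, u x = f x ∧ v x = w x := by
  intro x hx
  have := H.sub K hq hh hh
  rw [sub_self] at this
  have := this.eq_zero hq ha (by simp [hu]) (by simp [hv]) x hx
  simpa [sub_eq_zero] using this

theorem exists_isSol (hq : LocallyIntegrable q) (hh : LocallyIntegrable h) (a : ℝ) (y : ℂ × ℂ) :
    ∃ u v, IsSol q h univ u v ∧ u a = y.1 ∧ v a = y.2 := by
  have hih := intervalIntegrable_of_locallyIntegrable hh
  have hiq := intervalIntegrable_of_locallyIntegrable hq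
  obtain ⟨Y, hY, e⟩ := volterra_exists (locallyIntegrable_sysMatrix hq) a
    (y₀ := fun x => (y.1, y.2 - ∫ t in a..x, h t))
    (continuous_const.prodMk (continuous_const.sub (intervalIntegral.continuous_primitive hih a)))
  have c1 : Continuous fun x => (Y x).1 := continuous_fst.comp hY
  have c2 : Continuous fun x => (Y x).2 := continuous_snd.comp hY
  have i1 : ∀ x y, IntervalIntegrable (fun t => q t * (Y t).1) volume x y := fun x y =>
    (hiq x y).mul_continuousOn c1.continuousOn
  have i2 : ∀ x y, IntervalIntegrable (fun t => (Y t).2) volume x y := fun x y =>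
    c2.intervalIntegrable x y
  simp only [sysMatrix_apply] at e
  have e' : ∀ x, Y x = (y.1, y.2 - ∫ t in a..x, h t) +
      (∫ t in a..x, (Y t).2, ∫ t in a..x, q t * (Y t).1) := fun x => by
    rw [← integral_prod_mk (i2 a x) (i1 a x)]; exact e x
  have e1 : ∀ x, (Y x).1 = y.1 + ∫ t in a..x, (Y t).2 := fun x => congrArg Prod.fst (e' x)
  have e2 : ∀ x, (Y x).2 = y.2 - (∫ t in a..x, h t) + ∫ t in a..x, q t * (Y t).1 := fun x =>
    congrArg Prod.snd (e' x)
  refine ⟨fun x => (Y x).1, fun x => (Y x).2, ⟨c1.continuousOn, c2.continuousOn,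
    fun x _ z _ => ?_, fun x _ z _ => ?_⟩, by simpa using e1 a, by simpa using e2 a⟩
  · rw [e1 z, e1 x, ← intervalIntegral.integral_add_adjacent_intervals (i2 a x) (i2 x z)]
    ring
  · rw [intervalIntegral.integral_sub (i1 x z) (hih x z), e2 z, e2 x,
      ← intervalIntegral.integral_add_adjacent_intervals (i1 a x) (i1 x z),
      ← intervalIntegral.integral_add_adjacent_intervals (hih a x) (hih x z)]
    ring

/-- The coefficients live on the whole line, so the global solution with the same data at a
restricts to the given one by uniqueness. This reduces questions at the endpoints of S to two-sided
ones. -/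
theorem IsSol.extend [S.OrdConnected] (hq : LocallyIntegrable q) (hh : LocallyIntegrable h)
    (H : IsSol q h S u v) {a : ℝ} (ha : a ∈ S) :
    ∃ u' v', IsSol q h univ u' v' ∧ u' a = u a ∧ v' a = v a ∧
      ∀ x ∈ S, u x = u' x ∧ v x = v' x := by
  obtain ⟨u', v', H', e1, e2⟩ := exists_isSol hq hh a (u a, v a)
  exact ⟨u', v', H', e1, e2, H.unique hq hh (H'.mono (subset_univ S)) ha e1.symm e2.symm⟩

end IVP

/-! ### Equivalence of the integral form and the differential expression -/

section Regularity

variable {q h k : ℝ → ℂ} {S : Set ℝ} {u v f w : ℝ → ℂ}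

theorem IsSol.hasDerivAt (H : IsSol q h univ u v) (x : ℝ) : HasDerivAt u (v x) x := by
  have hc : Continuous v := continuousOn_univ.1 H.cont_v
  have : u = fun y => u x + ∫ t in x..y, v t := by
    funext y
    rw [← H.eq_u x trivial y trivial]
    ring
  rw [this]
  exact (hc.integral_hasStrictDerivAt x x).hasDerivAt.const_add _

theorem IsSol.ae_hasDerivAt (hq : LocallyIntegrable q) (hh : LocallyIntegrable h)
    (H : IsSol q h univ u v) : ∀ᵐ x, HasDerivAt v (q x * u x - h x) x := by
  have hc : Continuous u := continuousOn_univ.1 H.cont_u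
  have hl : LocallyIntegrable fun t => q t * u t - h t := by
    refine LocallyIntegrable.sub ?_ hh
    rw [locallyIntegrable_iff] at hq ⊢
    exact fun K hK => (hq K hK).mul_continuousOn hc.continuousOn hK
  filter_upwards [LocallyIntegrable.ae_hasDerivAt_integral hl] with x hx
  have : v = fun y => v x + ∫ t in x..y, (q t * u t - h t) := by
    funext y
    rw [← H.eq_v x trivial y trivial]
    ring
  rw [this]
  exact (hx x).const_add _

theorem IsSol.locAC [hS : S.OrdConnected] (H : IsSol q h S u v) : LocAC u S := by
  intro x hx y hy
  have hsub := hS.uIcc_subset hx hy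
  refine AC.of_dist_le (AC.integral (H.intervalIntegrable_v hx hy) left_mem_uIcc) ?_
  intro s hs t ht
  rw [dist_eq_norm, dist_eq_norm, ← H.eq_u x hx _ (hsub hs), ← H.eq_u x hx _ (hsub ht)]
  simp

theorem IsSol.locAC_v [hS : S.OrdConnected] (hq : LocallyIntegrable q) (hh : LocallyIntegrable h)
    (H : IsSol q h S u v) : LocAC v S := by
  intro x hx y hy
  have hsub := hS.uIcc_subset hx hy
  refine AC.of_dist_le (AC.integral (H.intervalIntegrable_rhs hq hh hx hy) left_mem_uIcc) ?_
  intro s hs t ht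
  rw [dist_eq_norm, dist_eq_norm, ← H.eq_v x hx _ (hsub hs), ← H.eq_v x hx _ (hsub ht)]
  simp

theorem IsSol.derivWithin [S.OrdConnected] (hS : UniqueDiffOn ℝ S) (hq : LocallyIntegrable q)
    (hh : LocallyIntegrable h) (H : IsSol q h S u v) :
    ∀ x ∈ S, HasDerivWithinAt u (v x) S x ∧ derivWithin u S x = v x := by
  intro x hx
  obtain ⟨u', v', H', e1, e2, e⟩ := H.extend hq hh hx
  have : HasDerivWithinAt u (v x) S x :=
    ((H'.hasDerivAt x).hasDerivWithinAt.congr (fun y hy => (e y hy).1) (e x hx).1).congr_deriv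
      (e x hx).2.symm
  exact ⟨this, this.derivWithin (hS x hx)⟩

theorem IsSol.reg [S.OrdConnected] (hS : UniqueDiffOn ℝ S) (hq : LocallyIntegrable q)
    (hh : LocallyIntegrable h) (H : IsSol q h S u v) : Reg u S :=
  ⟨fun x hx => (H.derivWithin hS hq hh x hx).1.differentiableWithinAt, H.locAC,
    (H.locAC_v hq hh).congr fun x hx => (H.derivWithin hS hq hh x hx).2.symm⟩

theorem IsSol.diffExpr_ae_eq {V : ℝ → ℝ} {z : ℂ} [hSo : S.OrdConnected] (hS : UniqueDiffOn ℝ S)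
    (hV : LocallyIntegrable V) (hh : LocallyIntegrable h) (H : IsSol (pot V z) h S u v) :
    ∀ᵐ x ∂volume.restrict S, diffExpr V S u x = z * u x + h x := by
  have hq := locallyIntegrable_pot hV z
  rcases S.eq_empty_or_nonempty with rfl | ⟨a, ha⟩
  · simp
  obtain ⟨u', v', H', e1, e2, e⟩ := H.extend hq hh ha
  filter_upwards [ae_restrict_of_ae (H'.ae_hasDerivAt hq hh), ae_restrict_mem hSo.measurableSet]
    with x hx hxS
  have h1 : EqOn (_root_.derivWithin u S) v S := fun y hy => (H.derivWithin hS hq hh y hy).2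
  have h2 : HasDerivWithinAt v (pot V z x * u' x - h x) S x :=
    hx.hasDerivWithinAt.congr (fun y hy => (e y hy).2) (e x hxS).2
  simp only [diffExpr]
  rw [derivWithin_congr h1 (h1 hxS), h2.derivWithin (hS x hxS), (e x hxS).1, pot]
  ring

theorem exists_Icc_mem_nhdsWithin {x : ℝ} (hx : x ∈ S) :
    ∃ a ∈ S, ∃ b ∈ S, a ≤ x ∧ x ≤ b ∧ Icc a b ∈ 𝓝[S] x := by
  have h1 : ∃ a ∈ S, a ≤ x ∧ Ici a ∈ 𝓝[S] x := by
    by_cases h : ∃ a ∈ S, a < x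
    · obtain ⟨a, ha, hax⟩ := h
      exact ⟨a, ha, hax.le, mem_nhdsWithin_of_mem_nhds (Ici_mem_nhds hax)⟩
    · push Not at h
      exact ⟨x, hx, le_rfl, mem_of_superset self_mem_nhdsWithin fun y hy => h y hy⟩
  have h2 : ∃ b ∈ S, x ≤ b ∧ Iic b ∈ 𝓝[S] x := by
    by_cases h : ∃ b ∈ S, x < b
    · obtain ⟨b, hb, hbx⟩ := h
      exact ⟨b, hb, hbx.le, mem_nhdsWithin_of_mem_nhds (Iic_mem_nhds hbx)⟩
    · push Not at h
      exact ⟨x, hx, le_rfl, mem_of_superset self_mem_nhdsWithin fun y hy => h y hy⟩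
  obtain ⟨a, ha, hax, ha'⟩ := h1
  obtain ⟨b, hb, hbx, hb'⟩ := h2
  exact ⟨a, ha, b, hb, hax, hbx, by rw [← Ici_inter_Iic]; exact inter_mem ha' hb'⟩

theorem LocAC.continuousOn [S.OrdConnected] {f : ℝ → ℂ} (hf : LocAC f S) :
    ContinuousOn f S := by
  intro x hx
  obtain ⟨a, ha, b, hb, hax, hxb, hn⟩ := exists_Icc_mem_nhdsWithin hx
  have := (hf a ha b hb).continuousOn x (by rw [uIcc_of_le (hax.trans hxb)]; exact ⟨hax, hxb⟩)
  rw [uIcc_of_le (hax.trans hxb)] at this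
  exact this.mono_of_mem_nhdsWithin hn

/-- A regular function with `𝒜 u = z u + h` a.e. on `S` satisfies the integral equation. -/
theorem Reg.isSol {V : ℝ → ℝ} {z : ℂ} [hSo : S.OrdConnected] (hu : Reg u S)
    (e : ∀ᵐ x ∂volume.restrict S, diffExpr V S u x = z * u x + h x) :
    IsSol (pot V z) h S u (_root_.derivWithin u S) := by
  -- Apart from the right endpoint, a null set, S is a neighbourhood of each point of the interval,
  -- so derivatives within S are ordinary derivatives there.
  have hnhds : ∀ x ∈ S, ∀ y ∈ S, ∀ᵐ t, t ∈ uIoc x y → t ∈ S ∧ S ∈ 𝓝 t := by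
    intro x hx y hy
    filter_upwards [ae_ne (max x y)] with t ht ht'
    rw [uIoc, mem_Ioc] at ht'
    have hIcc := hSo.uIcc_subset hx hy
    have h2 : t < max x y := lt_of_le_of_ne ht'.2 ht
    have : S ∈ 𝓝 t := mem_of_superset (Icc_mem_nhds ht'.1 h2) hIcc
    exact ⟨mem_of_mem_nhds this, this⟩
  refine ⟨hu.diff.continuousOn, hu.ac_deriv.continuousOn, fun x hx y hy => ?_, fun x hx y hy => ?_⟩
  · refine (AC.integral_eq_sub (hu.ac x hx y hy) ?_).2.symm
    filter_upwards [hnhds x hx y hy] with t ht h'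
    obtain ⟨h1, h2⟩ := ht h'
    exact (hu.diff t h1).hasDerivWithinAt.hasDerivAt h2
  · refine (AC.integral_eq_sub (hu.ac_deriv x hx y hy) ?_).2.symm
    filter_upwards [hnhds x hx y hy, ae_uIoc_of_ae_restrict e hx hy,
      ae_uIoc_of_ae_restrict hu.ac_deriv.ae_diff hx hy] with t ht h3 h4 h'
    obtain ⟨h1, h2⟩ := ht h'
    refine ((h4 h').hasDerivWithinAt.hasDerivAt h2).congr_deriv ?_
    have := h3 h'
    simp only [diffExpr] at this
    simp only [pot]
    linear_combination -this

end Regularity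

/-! ### Green's identity -/

section Green

variable {q h k : ℝ → ℂ} {u v f w : ℝ → ℂ}

/-- Green's identity. -/
theorem IsSol.green (hq : LocallyIntegrable q) (hh : LocallyIntegrable h)
    (hk : LocallyIntegrable k) (H : IsSol q h univ u v) (K : IsSol q k univ f w) (a b : ℝ) :
    ∫ t in a..b, (h t * f t - u t * k t) =
      (u b * w b - v b * f b) - (u a * w a - v a * f a) := by
  have ac1 := (H.locAC a trivial b trivial).fun_smul (K.locAC_v hq hk a trivial b trivial)
  have ac2 := (H.locAC_v hq hh a trivial b trivial).fun_smul (K.locAC a trivial b trivial)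
  refine (AC.integral_eq_sub (ac1.sub ac2) ?_).2
  filter_upwards [H.ae_hasDerivAt hq hh, K.ae_hasDerivAt hq hk] with t h1 h2 _
  refine (((H.hasDerivAt t).mul h2).sub (h1.mul (K.hasDerivAt t))).congr_deriv ?_
  ring

theorem IsSol.data_eq_zero (hq : LocallyIntegrable q) (H : IsSol q 0 univ u v) {a b : ℝ}
    (hab : a ≠ b) (h0 : ∫ t in a..b, ‖u t‖ ^ 2 = 0) : u a = 0 ∧ v a = 0 := by
  have hc : Continuous u := continuousOn_univ.1 H.cont_u
  have hz : ∀ x ∈ uIcc a b, u x = 0 := by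
    have key : ∀ c d : ℝ, c < d → ∫ t in c..d, ‖u t‖ ^ 2 = 0 → ∀ x ∈ Icc c d, u x = 0 := by
      intro c d hcd h0 x hx
      by_contra hne
      have := intervalIntegral.integral_pos hcd (f := fun t => ‖u t‖ ^ 2)
        (by fun_prop) (fun _ _ => by positivity) ⟨x, hx, by positivity⟩
      linarith
    rcases lt_or_gt_of_ne hab with h | h
    · rw [uIcc_of_le h.le]
      exact key a b h h0
    · rw [uIcc_of_ge h.le]
      refine key b a h ?_
      rw [intervalIntegral.integral_symm, h0, neg_zero]
  refine ⟨hz a left_mem_uIcc, ?_⟩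
  have hU : UniqueDiffOn ℝ (uIcc a b) :=
    uniqueDiffOn_Icc (min_lt_max.2 hab)
  have := ((H.mono (subset_univ (uIcc a b))).derivWithin hU hq locallyIntegrable_zero a
    left_mem_uIcc).2
  rw [← this, derivWithin_congr (f₁ := u) (f := fun _ => 0) hz (hz a left_mem_uIcc)]
  simp

end Green

/-! ### Controllability and compactly supported functions with prescribed data -/

section Steering

variable {q : ℝ → ℂ}

/-- A solution with arbitrary data at `a` can be steered to zero data at `b` by a continuous
source. -/
theorem exists_steering_source (hq : LocallyIntegrable q) (hr : ∀ t, starRingEnd ℂ (q t) = q t)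
    {a b : ℝ} (hab : a ≠ b) (y : ℂ × ℂ) :
    ∃ h : ℝ → ℂ, Continuous h ∧ ∀ u v, IsSol q h (uIcc a b) u v → u a = y.1 → v a = y.2 →
      u b = 0 ∧ v b = 0 := by
  have h0 : LocallyIntegrable (0 : ℝ → ℂ) := locallyIntegrable_zero
  choose U W hUW hU hW using fun y => exists_isSol hq h0 a y
  have hUc : ∀ y, Continuous (U y) := fun y => continuousOn_univ.1 (hUW y).cont_u
  choose F G hFG hF hG using fun y => exists_isSol hq (hUc y).locallyIntegrable a (0, 0)
  have uadd : ∀ y y', U (y + y') = U y + U y' := fun y y' => by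
    funext x
    have := (hUW y).add (hUW y') hq h0 h0
    rw [add_zero] at this
    exact ((hUW (y + y')).unique hq h0 this (mem_univ a) (by simp [hU]) (by simp [hW])
      x trivial).1
  have usmul : ∀ (c : ℂ) y, U (c • y) = c • U y := fun c y => by
    funext x
    have := (hUW y).smul c
    rw [smul_zero] at this
    exact ((hUW (c • y)).unique hq h0 this (mem_univ a) (by simp [hU]) (by simp [hW])
      x trivial).1
  let T : ℂ × ℂ →ₗ[ℂ] ℂ × ℂ :=
    { toFun := fun y => (F y b, G y b)
      map_add' := fun y y' => by
        have := (hFG y).add (hFG y') hq (hUc y).locallyIntegrable (hUc y').locallyIntegrable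
        rw [← uadd] at this
        have := (hFG (y + y')).unique hq (hUc _).locallyIntegrable this (mem_univ a)
          (by simp [hF]) (by simp [hG]) b trivial
        exact Prod.ext this.1 this.2
      map_smul' := fun c y => by
        have := (hFG y).smul c
        rw [← usmul] at this
        have := (hFG (c • y)).unique hq (hUc _).locallyIntegrable this (mem_univ a)
          (by simp [hF]) (by simp [hG]) b trivial
        exact Prod.ext this.1 this.2 }
  have hT : Function.Injective T := by
    rw [injective_iff_map_eq_zero]
    -- Injectivity of this controllability map: q is real, so the conjugate of `U y` solves the
    -- homogeneous equation. Since `F y` has zero data at both ends, Green's identity gives ∫|U y|²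
    -- = 0.
    intro y hy
    obtain ⟨e1, e2⟩ : F y b = 0 ∧ G y b = 0 := Prod.mk_eq_zero.1 hy
    have K := (hUW y).conj
    simp only [hr, Pi.zero_apply, map_zero] at K
    have g := (hFG y).green hq (hUc y).locallyIntegrable locallyIntegrable_zero K a b
    rw [e1, e2, hF, hG] at g
    have e3 : ∀ t, U y t * starRingEnd ℂ (U y t) - F y t * 0 = ((‖U y t‖ ^ 2 : ℝ) : ℂ) := by
      intro t
      rw [Complex.mul_conj, Complex.normSq_eq_norm_sq]
      simp
    simp only [e3] at g
    rw [intervalIntegral.integral_ofReal] at g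
    have g' : ∫ t in a..b, ‖U y t‖ ^ 2 = 0 := by
      have : ((∫ t in a..b, ‖U y t‖ ^ 2 : ℝ) : ℂ) = 0 := by rw [g]; simp
      exact_mod_cast this
    obtain ⟨d1, d2⟩ := (hUW y).data_eq_zero hq hab g'
    exact Prod.ext (by rw [← hU y, d1]; rfl) (by rw [← hW y, d2]; rfl)
  -- By finite dimension `T` is also surjective, so some source `U y₀` produces at b the negative of
  -- the data reached by the free evolution of y.
  obtain ⟨y₀, hy₀⟩ := LinearMap.injective_iff_surjective.1 hT (-(U y b, W y b))
  have hy₀' : F y₀ b = -U y b ∧ G y₀ b = -W y b := Prod.mk_inj.1 hy₀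
  refine ⟨U y₀, hUc y₀, fun u v H hu hv => ?_⟩
  have := (hUW y).add (hFG y₀) hq h0 (hUc y₀).locallyIntegrable
  rw [zero_add] at this
  have := H.unique hq (hUc y₀).locallyIntegrable (this.mono (subset_univ _)) left_mem_uIcc
    (by simp [hu, hU, hF]) (by simp [hv, hW, hG]) b right_mem_uIcc
  simpa [hy₀'.1, hy₀'.2] using this

theorem memLp_indicator_of_continuous {f : ℝ → ℂ} (hf : Continuous f) (a b : ℝ) :
    MemLp ((Icc a b).indicator f) 2 volume := by
  rw [memLp_indicator_iff_restrict measurableSet_Icc]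
  obtain ⟨C, hC⟩ := (isCompact_Icc (a := a) (b := b)).exists_bound_of_continuousOn hf.continuousOn
  exact MemLp.of_bound hf.aestronglyMeasurable C
    ((ae_restrict_iff' measurableSet_Icc).2 (.of_forall hC))

theorem locallyIntegrable_of_memLp {f : ℝ → ℂ} (hf : MemLp f 2 volume) : LocallyIntegrable f :=
  hf.locallyIntegrable (by norm_num)

/-- There are functions with arbitrary data at `a` and compact support in the domain of the
Schrödinger operator. -/
theorem exists_compact_support (hq : LocallyIntegrable q) (hr : ∀ t, starRingEnd ℂ (q t) = q t)
    (a : ℝ) (y : ℂ × ℂ) :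
    ∃ f w h, IsSol q h univ f w ∧ f a = y.1 ∧ w a = y.2 ∧ f (a + 1) = 0 ∧ w (a + 1) = 0 ∧
      MemLp f 2 volume ∧ MemLp h 2 volume := by
  obtain ⟨hR, hRc, steerR⟩ := exists_steering_source hq hr (a := a) (b := a + 1) (by simp) y
  obtain ⟨hL, hLc, steerL⟩ := exists_steering_source hq hr (a := a) (b := a - 1)
    (by intro h; linarith) y
  rw [uIcc_of_le (by linarith)] at steerR
  rw [uIcc_of_ge (by linarith)] at steerL
  -- The two steering sources overlap only at a, a null set. Beyond a - 1 and a + 1 the source and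
  -- the data vanish, hence so does the solution.
  set h : ℝ → ℂ := (Icc (a - 1) a).indicator hL + (Icc a (a + 1)).indicator hR with hh
  have hm : MemLp h 2 volume :=
    (memLp_indicator_of_continuous hLc _ _).add (memLp_indicator_of_continuous hRc _ _)
  have hl := locallyIntegrable_of_memLp hm
  obtain ⟨f, w, H, hf, hw⟩ := exists_isSol hq hl a y
  obtain ⟨r1, r2⟩ := steerR f w ((H.mono (subset_univ _)).congr_source (by
    filter_upwards [ae_restrict_of_ae (ae_ne a), ae_restrict_mem measurableSet_Icc] with t ht ht'
    have : t ∉ Icc (a - 1) a := fun h => ht (le_antisymm h.2 ht'.1)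
    simp [hh, ht', indicator_of_notMem this])) hf hw
  obtain ⟨l1, l2⟩ := steerL f w ((H.mono (subset_univ _)).congr_source (by
    filter_upwards [ae_restrict_of_ae (ae_ne a), ae_restrict_mem measurableSet_Icc] with t ht ht'
    have : t ∉ Icc a (a + 1) := fun h => ht (le_antisymm ht'.2 h.1)
    simp [hh, ht', indicator_of_notMem this])) hf hw
  have hR0 : ∀ x ∈ Ici (a + 1), f x = 0 ∧ w x = 0 := by
    refine IsSol.eq_zero hq ((H.mono (subset_univ _)).congr_source ?_) self_mem_Ici r1 r2
    filter_upwards [ae_restrict_of_ae (ae_ne (a + 1)), ae_restrict_mem measurableSet_Ici]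
      with t ht ht'
    have ht2 : a + 1 < t := lt_of_le_of_ne ht' (Ne.symm ht)
    have h1 : t ∉ Icc a (a + 1) := fun h => by linarith [h.2]
    have h2 : t ∉ Icc (a - 1) a := fun h => by linarith [h.2]
    simp [hh, indicator_of_notMem h1, indicator_of_notMem h2]
  have hL0 : ∀ x ∈ Iic (a - 1), f x = 0 ∧ w x = 0 := by
    refine IsSol.eq_zero hq ((H.mono (subset_univ _)).congr_source ?_) self_mem_Iic l1 l2
    filter_upwards [ae_restrict_of_ae (ae_ne (a - 1)), ae_restrict_mem measurableSet_Iic]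
      with t ht ht'
    have ht2 : t < a - 1 := lt_of_le_of_ne ht' ht
    have h1 : t ∉ Icc a (a + 1) := fun h => by linarith [h.1]
    have h2 : t ∉ Icc (a - 1) a := fun h => by linarith [h.1]
    simp [hh, indicator_of_notMem h1, indicator_of_notMem h2]
  refine ⟨f, w, h, H, hf, hw, r1, r2, ?_, hm⟩
  have hfc : Continuous f := continuousOn_univ.1 H.cont_u
  refine hfc.memLp_of_hasCompactSupport
    (HasCompactSupport.intro (isCompact_Icc (a := a - 1) (b := a + 1)) fun x hx => ?_)
  by_cases h1 : x ≤ a - 1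
  · exact (hL0 x h1).1
  · exact (hR0 x (by
      by_contra h2
      exact hx ⟨(not_le.1 h1).le, (not_le.1 h2).le⟩)).1

end Steering

/-! ### Square integrable solutions for non-real spectral parameter -/

section Weyl

variable {V : ℝ → ℝ} {z : ℂ} {u v : ℝ → ℂ}

/-- Green's identity for u and its conjugate. The latter solves the equation with the same potential
V - z and the source (z̄ - z)ū. -/
theorem IsSol.im_mul_integral (hV : LocallyIntegrable V) (H : IsSol (pot V z) 0 univ u v)
    (a b : ℝ) : z.im * ∫ t in a..b, ‖u t‖ ^ 2 =
      (v a * starRingEnd ℂ (u a)).im - (v b * starRingEnd ℂ (u b)).im := by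
  have hq := locallyIntegrable_pot hV z
  have hc : Continuous u := continuousOn_univ.1 H.cont_u
  have K : IsSol (pot V z) (fun t => (starRingEnd ℂ z - z) * starRingEnd ℂ (u t)) univ _ _ :=
    H.conj.congr_coeff (.of_forall fun t => by simp [pot]; ring)
  have g := H.green hq locallyIntegrable_zero
    (Continuous.locallyIntegrable (by fun_prop)) K a b
  have e : ∀ t, (0 : ℝ → ℂ) t * starRingEnd ℂ (u t) -
      u t * ((starRingEnd ℂ z - z) * starRingEnd ℂ (u t)) =
      (2 * Complex.I * z.im) * ((‖u t‖ ^ 2 : ℝ) : ℂ) := by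
    intro t
    have h1 : starRingEnd ℂ z - z = -(2 * Complex.I * z.im) := by
      apply Complex.ext <;> simp; ring
    rw [← Complex.normSq_eq_norm_sq, ← Complex.mul_conj, h1, Pi.zero_apply]
    ring
  have g' := (intervalIntegral.integral_congr fun t _ => e t).symm.trans g
  rw [intervalIntegral.integral_const_mul, intervalIntegral.integral_ofReal] at g'
  have := congrArg Complex.im g'
  simp at this
  simp
  linarith

/-- Weyl's nested discs in compact form: the unit data vectors whose solution has energy at most `B`
over the first n units of length form a decreasing sequence of non-empty compact sets. A common
point gives a solution of bounded energy. The values ε = 1 and ε = -1 serve the two half-lines. -/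
theorem exists_weyl_sol_aux (hV : LocallyIntegrable V) (hz : z.im ≠ 0) (a : ℝ) {ε : ℝ}
    (hε : ε ≠ 0) :
    ∃ u v, IsSol (pot V z) 0 univ u v ∧ u a ≠ 0 ∧
      ∃ C, ∀ n : ℕ, ∫ t in (0 : ℝ)..n, ‖u (ε * t + a)‖ ^ 2 ≤ C := by
  have hq := locallyIntegrable_pot hV z
  have h0 : LocallyIntegrable (0 : ℝ → ℂ) := locallyIntegrable_zero
  obtain ⟨c, c', hc, hc1, hc2⟩ := exists_isSol hq h0 a (1, 0)
  obtain ⟨s, s', hs, hs1, hs2⟩ := exists_isSol hq h0 a (0, 1)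
  have hcc : Continuous c := continuousOn_univ.1 hc.cont_u
  have hsc : Continuous s := continuousOn_univ.1 hs.cont_u
  let U : ℂ × ℂ → ℝ → ℂ := fun y => y.1 • c + y.2 • s
  let W : ℂ × ℂ → ℝ → ℂ := fun y => y.1 • c' + y.2 • s'
  have hU : ∀ y, IsSol (pot V z) 0 univ (U y) (W y) := fun y => by
    have := (hc.smul y.1).add (hs.smul y.2) hq (h0.smul _) (h0.smul _)
    simpa using this
  have hUa : ∀ y, U y a = y.1 := fun y => by simp [U, hc1, hs1]
  have hWa : ∀ y, W y a = y.2 := fun y => by simp [W, hc2, hs2]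
  have hUc : ∀ y, Continuous (U y) := fun y => continuousOn_univ.1 (hU y).cont_u
  let Q : ℕ → ℂ × ℂ → ℝ := fun n y => ∫ t in (0 : ℝ)..n, ‖U y (ε * t + a)‖ ^ 2
  have hQc : ∀ n, Continuous (Q n) := fun n => by
    refine intervalIntegral.continuous_parametric_intervalIntegral_of_continuous' ?_ _ _
    simp only [U, Pi.add_apply, Pi.smul_apply, smul_eq_mul, Function.uncurry_def]
    fun_prop
  have hQm : ∀ y, Monotone fun n => Q n y := fun y m n hmn => by
    refine intervalIntegral.integral_mono_interval le_rfl (by positivity) (by exact_mod_cast hmn)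
      (.of_forall fun t => by positivity) (Continuous.intervalIntegrable ?_ _ _)
    have := hUc y
    fun_prop
  have hQeq : ∀ n y, Q n y = ε⁻¹ * ∫ t in a..(ε * n + a), ‖U y t‖ ^ 2 := fun n y => by
    simp only [Q]
    rw [intervalIntegral.integral_comp_mul_add (fun t => ‖U y t‖ ^ 2) hε a]
    simp
  -- The energy that `IsSol.im_mul_integral` assigns to a solution vanishing at the far end; ε⁻¹
  -- comes from the change of variables.
  let B : ℂ × ℂ → ℝ := fun y => ε⁻¹ * (z.im⁻¹ * (y.2 * starRingEnd ℂ y.1).im)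
  have hB : Continuous B := by
    simp only [B]
    fun_prop
  let K : ℕ → Set (ℂ × ℂ) := fun n => Metric.sphere 0 1 ∩ {y | Q n y ≤ B y}
  have hKc : ∀ n, IsClosed (K n) := fun n =>
    Metric.isClosed_sphere.inter (isClosed_le (hQc n) hB)
  obtain ⟨y, hy⟩ : (⋂ n, K n).Nonempty := by
    refine IsCompact.nonempty_iInter_of_sequence_nonempty_isCompact_isClosed K ?_ ?_ ?_ hKc
    · exact fun n y hy => ⟨hy.1, (hQm y (Nat.le_succ n)).trans hy.2⟩
    · intro n
      -- The solution vanishing at the far end, normalized at a, attains equality `Q n y = B y`.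
      obtain ⟨θ, θ', hθ, hθ1, hθ2⟩ := exists_isSol hq h0 (ε * n + a) (0, 1)
      have hne : ((θ a, θ' a) : ℂ × ℂ) ≠ 0 := fun h => by
        obtain ⟨e1, e2⟩ := Prod.mk_eq_zero.1 h
        have := (hθ.eq_zero hq (mem_univ a) e1 e2 (ε * n + a) trivial).2
        rw [hθ2] at this
        exact one_ne_zero this
      set y : ℂ × ℂ := ((‖((θ a, θ' a) : ℂ × ℂ)‖⁻¹ : ℝ) : ℂ) • (θ a, θ' a) with hy
      have hyn : ‖y‖ = 1 := by
        rw [hy, norm_smul, Complex.norm_real, norm_inv, norm_norm, inv_mul_cancel₀]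
        exact norm_ne_zero_iff.2 hne
      refine ⟨y, by simpa using hyn, ?_⟩
      have hs := hθ.smul ((‖((θ a, θ' a) : ℂ × ℂ)‖⁻¹ : ℝ) : ℂ)
      rw [smul_zero] at hs
      have hb : U y (ε * n + a) = 0 := by
        rw [((hU y).unique hq h0 hs (mem_univ a) (by rw [hUa]; rfl) (by rw [hWa]; rfl)
          (ε * n + a) trivial).1]
        simp [hθ1]
      have hi := (hU y).im_mul_integral hV a (ε * n + a)
      rw [hb, hUa, hWa] at hi
      simp only [map_zero, mul_zero, Complex.zero_im, sub_zero] at hi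
      simp only [mem_ofPred_eq, B]
      rw [hQeq, ← hi, inv_mul_cancel_left₀ hz]
    · exact (isCompact_sphere _ _).inter_right (isClosed_le (hQc 0) hB)
  rw [mem_iInter] at hy
  -- If u(a) = 0, then `B y` = 0, so u has zero energy on the first unit interval and y = 0,
  -- contradicting ‖y‖ = 1.
  refine ⟨U y, W y, hU y, fun h => ?_, B y, fun n => (hy n).2⟩
  rw [hUa] at h
  have h1 : Q 1 y ≤ B y := (hy 1).2
  have hB0 : B y = 0 := by simp [B, h]
  have h2 : Q 1 y = 0 := le_antisymm (h1.trans hB0.le)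
    (intervalIntegral.integral_nonneg (by simp) fun _ _ => by positivity)
  rw [hQeq, mul_eq_zero, or_iff_right (inv_ne_zero hε)] at h2
  have := ((hU y).data_eq_zero hq (by simpa using hε) h2).2
  rw [hWa] at this
  have hy0 : y = 0 := Prod.ext h this
  have := (hy 0).1
  simp [hy0] at this

theorem memLp_of_sq_integrableOn {S : Set ℝ} {f : ℝ → ℂ} (hf : Continuous f)
    (h : IntegrableOn (fun t => ‖f t‖ ^ 2) S) : MemLp f 2 (volume.restrict S) :=
  (memLp_two_iff_integrable_sq_norm hf.aestronglyMeasurable).2 h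

/-- For non-real `z` there is a solution in `L²` at `+∞` that does not vanish at `a`. -/
theorem exists_weyl_sol_Ici (hV : LocallyIntegrable V) (hz : z.im ≠ 0) (a : ℝ) :
    ∃ u v, IsSol (pot V z) 0 univ u v ∧ u a ≠ 0 ∧ MemLp u 2 (volume.restrict (Ici a)) := by
  obtain ⟨u, v, H, hu, C, hC⟩ := exists_weyl_sol_aux hV hz a one_ne_zero
  have hc : Continuous u := continuousOn_univ.1 H.cont_u
  have hc2 : Continuous fun t => ‖u t‖ ^ 2 := by fun_prop
  refine ⟨u, v, H, hu, memLp_of_sq_integrableOn hc ?_⟩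
  rw [integrableOn_Ici_iff_integrableOn_Ioi]
  refine integrableOn_Ioi_of_intervalIntegral_norm_bounded C a (l := atTop)
    (b := fun n : ℕ => (n : ℝ) + a) (fun n => hc2.integrableOn_Ioc)
    (tendsto_atTop_add_const_right _ _ tendsto_natCast_atTop_atTop) (.of_forall fun n => ?_)
  have := hC n
  rw [intervalIntegral.integral_comp_mul_add (fun t => ‖u t‖ ^ 2) one_ne_zero a] at this
  simpa using this

/-- For non-real `z` there is a solution in `L²` at `-∞` that does not vanish at `a`. -/
theorem exists_weyl_sol_Iic (hV : LocallyIntegrable V) (hz : z.im ≠ 0) (a : ℝ) :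
    ∃ u v, IsSol (pot V z) 0 univ u v ∧ u a ≠ 0 ∧ MemLp u 2 (volume.restrict (Iic a)) := by
  obtain ⟨u, v, H, hu, C, hC⟩ := exists_weyl_sol_aux hV hz a (neg_ne_zero.2 (one_ne_zero (α := ℝ)))
  have hc : Continuous u := continuousOn_univ.1 H.cont_u
  have hc2 : Continuous fun t => ‖u t‖ ^ 2 := by fun_prop
  refine ⟨u, v, H, hu, memLp_of_sq_integrableOn hc ?_⟩
  refine integrableOn_Iic_of_intervalIntegral_norm_bounded C a (l := atTop)
    (a := fun n : ℕ => -(n : ℝ) + a) (fun n => hc2.integrableOn_Ioc)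
    (tendsto_atBot_add_const_right _ _
      (tendsto_neg_atTop_atBot.comp tendsto_natCast_atTop_atTop)) (.of_forall fun n => ?_)
  have := hC n
  rw [intervalIntegral.integral_comp_mul_add (fun t => ‖u t‖ ^ 2) (by norm_num) a] at this
  rw [intervalIntegral.integral_symm]
  simpa [inv_neg] using this

end Weyl

/-! ### Analyticity of the resolvent -/

section Resolvent

variable {E : Type*} [NormedAddCommGroup E] [NormedSpace ℂ E] [CompleteSpace E]

/-- The resolvent extends analytically to a neighbourhood of a point of the resolvent set. -/
theorem IsResolventAt.exists_analyticAt {T : E →ₗ.[ℂ] E} {z₀ : ℂ} {R₀ : E →L[ℂ] E}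
    (h : IsResolventAt T z₀ R₀) :
    ∃ R : ℂ → E →L[ℂ] E, AnalyticAt ℂ R z₀ ∧ ∀ᶠ z in 𝓝 z₀, IsResolventAt T z (R z) := by
  -- On the domain, T - z = (T - z₀) - (z - z₀). Hence the inverse must be R₀(1 - (z - z₀)R₀)⁻¹,
  -- which exists for z near z₀.
  let B : ℂ → E →L[ℂ] E := fun z => 1 - (z - z₀) • R₀
  have hB : AnalyticAt ℂ B z₀ := by
    refine analyticAt_const.sub ?_
    exact (analyticAt_id.sub analyticAt_const).smul analyticAt_const
  have hB0 : B z₀ = 1 := by simp [B]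
  have hinv : AnalyticAt ℂ (fun z => Ring.inverse (B z)) z₀ := by
    have h1 : AnalyticAt ℂ Ring.inverse (B z₀) := by
      rw [hB0]
      exact analyticAt_inverse (𝕜 := ℂ) (1 : (E →L[ℂ] E)ˣ)
    exact h1.comp hB
  have hunit : ∀ᶠ z in 𝓝 z₀, IsUnit (B z) := by
    have : {x : E →L[ℂ] E | IsUnit x} ∈ 𝓝 (B z₀) := by
      rw [hB0]
      exact Units.isOpen.mem_nhds isUnit_one
    exact hB.continuousAt this
  refine ⟨fun z => R₀ * Ring.inverse (B z), analyticAt_const.mul hinv, ?_⟩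
  filter_upwards [hunit] with z hz
  have hcomm : Commute R₀ (B z) := by
    refine (Commute.one_right _).sub_right ?_
    exact (Commute.refl R₀).smul_right _
  have hcomm' : R₀ * Ring.inverse (B z) = Ring.inverse (B z) * R₀ := by
    obtain ⟨b, hb⟩ := hz
    rw [← hb] at hcomm ⊢
    rw [Ring.inverse_unit]
    exact hcomm.units_inv_right
  refine ⟨fun g => ?_, fun f => ?_⟩
  · obtain ⟨hd, e⟩ := h.1 (Ring.inverse (B z) g)
    refine ⟨hd, ?_⟩
    have e1 : B z (Ring.inverse (B z) g) = g := by
      rw [← mul_apply_eq_comp, Ring.mul_inverse_cancel _ hz]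
      rfl
    have e2 : (Ring.inverse (B z) g) - (z - z₀) • R₀ (Ring.inverse (B z) g) = g := e1
    change T ⟨R₀ (Ring.inverse (B z) g), hd⟩ - z • R₀ (Ring.inverse (B z) g) = g
    rw [eq_add_of_sub_eq e]
    nth_rewrite 4 [← e2]
    rw [sub_smul]
    abel
  · rw [hcomm']
    have e1 : R₀ (T f - z • (f : E)) = B z f := by
      have := h.2 f
      have e2 : T f - z • (f : E) = (T f - z₀ • (f : E)) - (z - z₀) • (f : E) := by
        rw [sub_smul]; abel
      rw [e2, map_sub, this, map_smul]
      rfl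
    rw [mul_apply_eq_comp, e1, ← mul_apply_eq_comp,
      Ring.inverse_mul_cancel _ hz]
    rfl

end Resolvent

/-! ### The resolvent of H through solutions, and continuity of the data in the graph norm -/

section Graph

theorem ae_restrict_univ {p : ℝ → Prop} :
    (∀ᵐ x ∂volume.restrict univ, p x) ↔ ∀ᵐ x, p x := by rw [Measure.restrict_univ]

theorem memLp_restrict_univ {f : ℝ → ℂ} :
    MemLp f 2 (volume.restrict univ) ↔ MemLp f 2 volume := by rw [Measure.restrict_univ]

variable {V : ℝ → ℝ} {z : ℂ} {u v h : ℝ → ℂ}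

theorem graph_hamiltonian (V : ℝ → ℝ) : (hamiltonian V).graph = maxGraph V univ :=
  graph_maxOp V univ (by simp)

theorem IsResolventAt.mem_maxGraph {R : L2 univ →L[ℂ] L2 univ}
    (hR : IsResolventAt (hamiltonian V) z R) (g : L2 univ) :
    (R g, z • R g + g) ∈ maxGraph V univ := by
  obtain ⟨hd, e⟩ := hR.1 g
  rw [← graph_hamiltonian, add_comm, ← sub_eq_iff_eq_add.1 e]
  exact (hamiltonian V).mem_graph ⟨R g, hd⟩

theorem IsResolventAt.apply_of_mem_maxGraph {R : L2 univ →L[ℂ] L2 univ}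
    (hR : IsResolventAt (hamiltonian V) z R) {f f' : L2 univ} (hf : (f, f') ∈ maxGraph V univ) :
    R (f' - z • f) = f := by
  rw [← graph_hamiltonian, LinearPMap.mem_graph_iff] at hf
  obtain ⟨y, e1, e2⟩ := hf
  have := hR.2 y
  simp only at e1 e2
  rwa [e1, e2] at this

theorem exists_isSol_of_mem_maxGraph {f f' : L2 univ} (hf : (f, f') ∈ maxGraph V univ)
    (e : ∀ᵐ x, f' x = z * f x + h x) :
    ∃ u v, (∀ᵐ x, f x = u x) ∧ IsSol (pot V z) h univ u v := by
  obtain ⟨u, hu, h1, h2⟩ := hf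
  have h1' : f =ᵐ[volume.restrict univ] u := h1
  have h2' : f' =ᵐ[volume.restrict univ] diffExpr V univ u := h2
  refine ⟨u, _, ae_restrict_univ.1 h1', hu.isSol ?_⟩
  filter_upwards [h1', h2', ae_restrict_of_ae e] with x e1 e2 e3
  rw [← e2, e3, e1]

theorem mem_maxGraph_of_isSol (hV : LocallyIntegrable V) (hh : LocallyIntegrable h)
    (H : IsSol (pot V z) h univ u v) {f f' : L2 univ} (e1 : ∀ᵐ x, f x = u x)
    (e2 : ∀ᵐ x, f' x = z * u x + h x) : (f, f') ∈ maxGraph V univ := by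
  refine ⟨u, H.reg uniqueDiffOn_univ (locallyIntegrable_pot hV z) hh, ae_restrict_of_ae e1, ?_⟩
  change f' =ᵐ[volume.restrict univ] diffExpr V univ u
  filter_upwards [H.diffExpr_ae_eq uniqueDiffOn_univ hV hh, ae_restrict_of_ae e2] with x h1 h2
  rw [h1, h2]

/-- The class in `L²(ℝ)` of a square integrable function. -/
noncomputable def toL2 (f : ℝ → ℂ) (hf : MemLp f 2 volume) : L2 univ :=
  MemLp.toLp f (memLp_restrict_univ.2 hf)

theorem coeFn_toL2 {f : ℝ → ℂ} (hf : MemLp f 2 volume) : ∀ᵐ x, toL2 f hf x = f x :=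
  ae_restrict_univ.1 (MemLp.coeFn_toLp (memLp_restrict_univ.2 hf))

theorem coeFn_add_L2 (f g : L2 univ) : ∀ᵐ x, (f + g : L2 univ) x = f x + g x :=
  ae_restrict_univ.1 (Lp.coeFn_add f g)

theorem coeFn_sub_L2 (f g : L2 univ) : ∀ᵐ x, (f - g : L2 univ) x = f x - g x :=
  ae_restrict_univ.1 (Lp.coeFn_sub f g)

theorem coeFn_smul_L2 (c : ℂ) (f : L2 univ) : ∀ᵐ x, (c • f : L2 univ) x = c * f x :=
  ae_restrict_univ.1 (Lp.coeFn_smul c f)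

theorem memLp_coeFn_L2 (f : L2 univ) : MemLp f 2 volume :=
  memLp_restrict_univ.1 (Lp.memLp f)

/-- The solution representing the value of the resolvent. -/
theorem IsResolventAt.exists_isSol {R : L2 univ →L[ℂ] L2 univ}
    (hR : IsResolventAt (hamiltonian V) z R) (g : L2 univ) :
    ∃ u v, (∀ᵐ x, R g x = u x) ∧ IsSol (pot V z) g univ u v := by
  refine exists_isSol_of_mem_maxGraph (hR.mem_maxGraph g) ?_
  filter_upwards [coeFn_add_L2 (z • R g) g, coeFn_smul_L2 z (R g)] with x h1 h2
  rw [h1, h2]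

theorem IsResolventAt.eq_of_isSol (hV : LocallyIntegrable V) {R : L2 univ →L[ℂ] L2 univ}
    (hR : IsResolventAt (hamiltonian V) z R) {f g : L2 univ} (H : IsSol (pot V z) h univ u v)
    (hf : ∀ᵐ x, f x = u x) (hg : ∀ᵐ x, g x = h x) : R g = f := by
  have H' := H.congr_source (ae_restrict_of_ae hg)
  have := hR.apply_of_mem_maxGraph (f := f) (f' := z • f + g)
    (mem_maxGraph_of_isSol hV (locallyIntegrable_of_memLp (memLp_coeFn_L2 g)) H' hf (by
      filter_upwards [coeFn_add_L2 (z • f) g, coeFn_smul_L2 z f, hf] with x h1 h2 h3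
      rw [h1, h2, h3]))
  rwa [add_sub_cancel_left] at this

/-- Integration against a square integrable function over a bounded interval is a bounded
functional on `L²(ℝ)`. -/
theorem exists_clm_integral {k : ℝ → ℂ} (hk : MemLp k 2 volume) {a b : ℝ} (hab : a ≤ b) :
    ∃ L : L2 univ →L[ℂ] ℂ, ∀ f : L2 univ, L f = ∫ t in a..b, f t * k t := by
  have hm : MemLp ((Ioc a b).indicator fun t => starRingEnd ℂ (k t)) 2 volume :=
    (hk.star).indicator measurableSet_Ioc
  refine ⟨innerSL ℂ (toL2 _ hm), fun f => ?_⟩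
  rw [innerSL_apply_apply, L2.inner_def, setIntegral_univ, intervalIntegral.integral_of_le hab,
    ← integral_indicator measurableSet_Ioc]
  refine integral_congr_ae ?_
  filter_upwards [coeFn_toL2 hm] with t ht
  rw [ht]
  by_cases h : t ∈ Ioc a b <;> simp [h]

/-- The values of a function and of its derivative at a point depend continuously on the function
in the graph norm of the operator. -/
theorem exists_clm_data (hV : LocallyIntegrable V) (a : ℝ) :
    ∃ A B : L2 univ →L[ℂ] ℂ × ℂ, ∀ (z : ℂ) (f g : L2 univ) (u v : ℝ → ℂ), (∀ᵐ x, f x = u x) →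
      IsSol (pot V z) g univ u v → (u a, v a) = A f + B (z • f + g) := by
  -- Spectral parameter 0 is used throughout, with zf + g = 𝒜u as source. Thus `A` and `B` do not
  -- depend on z, and the test functions exist because V is real.
  have hq := locallyIntegrable_pot hV 0
  have hr : ∀ t, starRingEnd ℂ (pot V 0 t) = pot V 0 t := fun t => by simp [pot]
  have key : ∀ y : ℂ × ℂ, ∃ A B : L2 univ →L[ℂ] ℂ, ∀ (z : ℂ) (f g : L2 univ) (u v : ℝ → ℂ),
      (∀ᵐ x, f x = u x) → IsSol (pot V z) g univ u v →
        v a * y.1 - u a * y.2 = A f + B (z • f + g) := by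
    intro y
    obtain ⟨φ, w, k, K, h1, h2, h3, h4, m1, m2⟩ := exists_compact_support hq hr a y
    obtain ⟨L1, hL1⟩ := exists_clm_integral m1 (a := a) (b := a + 1) (by linarith)
    obtain ⟨L2, hL2⟩ := exists_clm_integral m2 (a := a) (b := a + 1) (by linarith)
    refine ⟨-L2, L1, fun z f g u v hf H => ?_⟩
    have hu : Continuous u := continuousOn_univ.1 H.cont_u
    have hφ : Continuous φ := continuousOn_univ.1 K.cont_u
    have e1 : ∀ᵐ x, (z • f + g : Schrodinger.L2 univ) x = z * u x + g x := by
      filter_upwards [coeFn_add_L2 (z • f) g, coeFn_smul_L2 z f, hf] with x h1 h2 h3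
      rw [h1, h2, h3]
    have H' : IsSol (pot V 0) (z • f + g : Schrodinger.L2 univ) univ u v := by
      refine H.congr_coeff ?_
      filter_upwards [ae_restrict_of_ae e1] with x h1
      rw [h1]
      simp only [pot]
      ring
    have l1 := locallyIntegrable_of_memLp (memLp_coeFn_L2 (z • f + g))
    have l2 := locallyIntegrable_of_memLp m2
    -- The test function has data y at a and zero data at a + 1, so only the boundary term at a
    -- survives.
    have G := H'.green hq l1 l2 K a (a + 1)
    rw [intervalIntegral.integral_sub
      ((intervalIntegrable_of_locallyIntegrable l1 _ _).mul_continuousOn hφ.continuousOn)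
      ((intervalIntegrable_of_locallyIntegrable l2 _ _).continuousOn_mul hu.continuousOn),
      h1, h2, h3, h4] at G
    rw [_root_.neg_apply, hL1, hL2]
    have e2 : ∫ t in a..(a + 1), f t * k t = ∫ t in a..(a + 1), u t * k t := by
      refine intervalIntegral.integral_congr_ae ?_
      filter_upwards [hf] with t ht _
      rw [ht]
    rw [e2]
    linear_combination -G
  -- The bracket v(a)y₁ - u(a)y₂ is u(a) for y = (0, -1) and v(a) for y = (1, 0).
  obtain ⟨A1, B1, h1⟩ := key (0, -1)
  obtain ⟨A2, B2, h2⟩ := key (1, 0)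
  refine ⟨A1.prod A2, B1.prod B2, fun z f g u v hf H => ?_⟩
  have e1 := h1 z f g u v hf H
  have e2 := h2 z f g u v hf H
  simp only at e1 e2
  refine Prod.ext ?_ ?_
  · simpa using e1
  · simpa using e2

end Graph

/-! ### The data spaces of square integrable solutions and their analytic dependence on z -/

section WeylSpace

variable {V : ℝ → ℝ} {z : ℂ} {u v h : ℝ → ℂ}

/-- The data `(u(a), u'(a))` of the solutions of `𝒜 u = z u` that are square integrable on `S`. -/
def weylSpace (hV : LocallyIntegrable V) (z : ℂ) (S : Set ℝ) (a : ℝ) : Submodule ℂ (ℂ × ℂ) where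
  carrier := {y | ∃ u v, IsSol (pot V z) 0 univ u v ∧ u a = y.1 ∧ v a = y.2 ∧
    MemLp u 2 (volume.restrict S)}
  zero_mem' := ⟨0, 0, by simpa using (exists_isSol (locallyIntegrable_pot hV z)
    locallyIntegrable_zero 0 0).choose_spec.choose_spec.1.smul 0, rfl, rfl, MemLp.zero⟩
  add_mem' := by
    rintro y y' ⟨u, v, H, e1, e2, m⟩ ⟨u', v', H', e1', e2', m'⟩
    have := H.add H' (locallyIntegrable_pot hV z) locallyIntegrable_zero locallyIntegrable_zero
    rw [add_zero] at this
    exact ⟨u + u', v + v', this, by simp [e1, e1'], by simp [e2, e2'], m.add m'⟩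
  smul_mem' := by
    rintro c y ⟨u, v, H, e1, e2, m⟩
    have := H.smul c
    rw [smul_zero] at this
    exact ⟨c • u, c • v, this, by simp [e1], by simp [e2], m.const_smul c⟩

theorem mem_weylSpace_of_isSol (hV : LocallyIntegrable V) {S : Set ℝ} [hS : S.OrdConnected] {a : ℝ}
    (ha : a ∈ S) (H : IsSol (pot V z) h S u v) (h0 : ∀ᵐ x ∂volume.restrict S, h x = 0)
    (m : MemLp u 2 (volume.restrict S)) : (u a, v a) ∈ weylSpace hV z S a := by
  have H0 : IsSol (pot V z) 0 S u v := H.congr_source (by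
    filter_upwards [h0] with x hx
    rw [hx]
    rfl)
  obtain ⟨u', v', H', e1, e2, e⟩ := H0.extend (locallyIntegrable_pot hV z)
    locallyIntegrable_zero ha
  refine ⟨u', v', H', e1, e2, (memLp_congr_ae ?_).1 m⟩
  filter_upwards [ae_restrict_mem hS.measurableSet] with x hx using (e x hx).1

theorem memLp_of_Iic_of_Ici {f : ℝ → ℂ} {a : ℝ} (h1 : MemLp f 2 (volume.restrict (Iic a)))
    (h2 : MemLp f 2 (volume.restrict (Ici a))) : MemLp f 2 volume := by
  rw [← memLp_indicator_iff_restrict measurableSet_Iic] at h1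
  have h3 := h2.mono_measure (Measure.restrict_mono Ioi_subset_Ici_self le_rfl)
  rw [← memLp_indicator_iff_restrict measurableSet_Ioi] at h3
  have := h1.add h3
  rwa [← compl_Iic, indicator_self_add_compl] at this

/-- A point of the resolvent set is not an eigenvalue. Together with the existence of square
integrable solutions at both ends for non-real `z`, this excludes the limit circle case, so that
the results below hold whenever the resolvent set contains the point in question. -/
theorem disjoint_weylSpace (hV : LocallyIntegrable V) {z : ℂ} (hz : z ∈ rho (hamiltonian V))
    (a : ℝ) : Disjoint (weylSpace hV z (Ici a) a) (weylSpace hV z (Iic a) a) := by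
  rw [Submodule.disjoint_def]
  rintro y ⟨u, v, H, e1, e2, m⟩ ⟨u', v', H', e1', e2', m'⟩
  obtain ⟨R, hR⟩ := hz
  have hq := locallyIntegrable_pot hV z
  have huu : u' = u := funext fun x => (H'.unique hq locallyIntegrable_zero H (mem_univ a)
    (e1'.trans e1.symm) (e2'.trans e2.symm) x trivial).1
  rw [huu] at m'
  have mu : MemLp u 2 volume := memLp_of_Iic_of_Ici m' m
  have hz0 : ∀ᵐ x, (0 : L2 univ) x = (0 : ℝ → ℂ) x := ae_restrict_univ.1 (Lp.coeFn_zero _ _ _)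
  have := hR.eq_of_isSol hV H (coeFn_toL2 mu) hz0
  rw [map_zero] at this
  have hu : u = 0 := by
    refine (Continuous.ae_eq_iff_eq (μ := volume) (continuousOn_univ.1 H.cont_u)
      continuous_zero).1 ?_
    filter_upwards [coeFn_toL2 mu, hz0] with x h1 h2
    rw [← h1, ← this, h2]
  have hv : v a = 0 := by
    rw [← (H.hasDerivAt a).deriv, hu]
    simp
  exact Prod.ext (by rw [← e1, hu]; rfl) (by rw [← e2, hv]; rfl)

/-- The determinant of two vectors in the plane. -/
def det₂ (x y : ℂ × ℂ) : ℂ := x.1 * y.2 - x.2 * y.1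

/-- Two independent vectors of D would span the plane, by Cramer's rule, and so D would contain a
non-zero vector of D'. -/
theorem det₂_eq_zero_of_disjoint {D D' : Submodule ℂ (ℂ × ℂ)} (h : Disjoint D D') (h' : D' ≠ ⊥)
    {x y : ℂ × ℂ} (hx : x ∈ D) (hy : y ∈ D) : det₂ x y = 0 := by
  obtain ⟨w, hw, hw0⟩ := Submodule.exists_mem_ne_zero_of_ne_bot h'
  by_contra hd
  refine hw0 (Submodule.disjoint_def.1 h w ?_ hw)
  have : w = (det₂ w y / det₂ x y) • x + (det₂ x w / det₂ x y) • y := by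
    refine Prod.ext ?_ ?_
    · simp only [Prod.fst_add, Prod.smul_fst, smul_eq_mul]
      field_simp
      simp only [det₂]
      ring
    · simp only [Prod.snd_add, Prod.smul_snd, smul_eq_mul]
      field_simp
      simp only [det₂]
      ring
  rw [this]
  exact D.add_mem (D.smul_mem _ hx) (D.smul_mem _ hy)

theorem smul_eq_of_det₂_eq_zero {p x : ℂ × ℂ} (hp : p ≠ 0) (h : det₂ p x = 0) :
    ∃ c : ℂ, x = c • p := by
  simp only [det₂] at h
  by_cases h1 : p.1 = 0
  · have h2 : p.2 ≠ 0 := fun h2 => hp (Prod.ext h1 h2)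
    refine ⟨x.2 / p.2, Prod.ext ?_ ?_⟩
    · rw [h1, zero_mul, zero_sub, neg_eq_zero, mul_eq_zero, or_iff_right h2] at h
      simp [h, h1]
    · simp [h2]
  · refine ⟨x.1 / p.1, Prod.ext ?_ ?_⟩
    · simp [h1]
    · simp only [Prod.smul_snd, smul_eq_mul]
      field_simp
      linear_combination h

/-- Every point is approached vertically, away from the real axis. Identities known only off the
real axis thereby pass to real points by continuity or by the identity theorem. -/
theorem frequently_im_ne_zero (z₀ : ℂ) : ∃ᶠ z in 𝓝[≠] z₀, z.im ≠ 0 := by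
  obtain ⟨ε, hε, hne⟩ : ∃ ε : ℝ, ε ≠ 0 ∧ ∀ t : ℝ, 0 < t → z₀.im + ε * t ≠ 0 := by
    rcases le_or_gt 0 z₀.im with h | h
    · exact ⟨1, one_ne_zero, fun t ht => by linarith⟩
    · exact ⟨-1, by norm_num, fun t ht => by linarith⟩
  have ht : Tendsto (fun t : ℝ => z₀ + ((ε * t : ℝ) : ℂ) * Complex.I) (𝓝[>] 0) (𝓝[≠] z₀) := by
    refine tendsto_nhdsWithin_iff.2 ⟨?_, ?_⟩
    · have : Continuous fun t : ℝ => z₀ + ((ε * t : ℝ) : ℂ) * Complex.I := by fun_prop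
      have := this.tendsto 0
      simp only [mul_zero, Complex.ofReal_zero, zero_mul, add_zero] at this
      exact this.mono_left nhdsWithin_le_nhds
    · filter_upwards [self_mem_nhdsWithin] with t ht
      have : t ≠ 0 := ne_of_gt ht
      simp [hε, this]
  refine ht.frequently (Eventually.frequently ?_)
  filter_upwards [self_mem_nhdsWithin] with t ht
  simpa using hne t ht

/-- The projection of the plane of data onto the space of data square integrable at `+∞`, along
the space of data square integrable at `-∞`, depends analytically on the spectral parameter. -/
theorem exists_analytic_projection (hV : LocallyIntegrable V) {z₀ : ℂ}
    (hz : z₀ ∈ rho (hamiltonian V)) (a : ℝ) (e : ℂ × ℂ) :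
    ∃ p : ℂ → ℂ × ℂ, AnalyticAt ℂ p z₀ ∧ ∀ᶠ z in 𝓝 z₀, z ∈ rho (hamiltonian V) ∧
      p z ∈ weylSpace hV z (Ici a) a ∧ e - p z ∈ weylSpace hV z (Iic a) a := by
  obtain ⟨R₀, hR₀⟩ := hz
  obtain ⟨R, hRa, hR⟩ := hR₀.exists_analyticAt
  obtain ⟨A, B, hAB⟩ := exists_clm_data hV a
  obtain ⟨φ, w, k, K, h1, h2, -, -, m1, m2⟩ := exists_compact_support (locallyIntegrable_pot hV 0)
    (fun t => by simp [pot]) a e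
  have m1' : MemLp ((Iic a).indicator φ) 2 volume := m1.indicator measurableSet_Iic
  have m2' : MemLp ((Iic a).indicator k) 2 volume := m2.indicator measurableSet_Iic
  -- `G z` is (𝒜 - z)φ cut off to x ≤ a, where φ has data e at a. Then u = `R z (G z)` solves the
  -- homogeneous equation to the right of a and φ - u solves it to the left, which splits e into u's
  -- data in D₊ and a remainder in D₋.
  let G : ℂ → L2 univ := fun z => toL2 _ m2' - z • toL2 _ m1'
  have hG : AnalyticAt ℂ G z₀ := analyticAt_const.sub (analyticAt_id.smul analyticAt_const)
  have hGe : ∀ z, ∀ᵐ x, G z x = (Iic a).indicator k x - z * (Iic a).indicator φ x := fun z => by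
    filter_upwards [coeFn_sub_L2 (toL2 _ m2') (z • toL2 _ m1'), coeFn_smul_L2 z (toL2 _ m1'),
      coeFn_toL2 m1', coeFn_toL2 m2'] with x e1 e2 e3 e4
    rw [e1, e2, e3, e4]
  have hRG : AnalyticAt ℂ (fun z => R z (G z)) z₀ :=
    AnalyticAt.comp₂ (ContinuousLinearMap.analyticAt_bilinear
      (ContinuousLinearMap.id ℂ (L2 univ →L[ℂ] L2 univ)) (R z₀, G z₀)) hRa hG
  refine ⟨fun z => A (R z (G z)) + B (z • R z (G z) + G z), ?_, ?_⟩
  · exact ((A.analyticAt _).comp hRG).add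
      ((B.analyticAt _).comp ((analyticAt_id.smul hRG).add hG))
  · filter_upwards [hR] with z hRz
    obtain ⟨u, v, hu, H⟩ := hRz.exists_isSol (G z)
    rw [← hAB z (R z (G z)) (G z) u v hu H]
    have mu : MemLp u 2 volume := (memLp_congr_ae hu).1 (memLp_coeFn_L2 _)
    refine ⟨⟨R z, hRz⟩, mem_weylSpace_of_isSol hV self_mem_Ici (H.mono (subset_univ _)) ?_
      (mu.restrict _), ?_⟩
    · filter_upwards [ae_restrict_of_ae (hGe z), ae_restrict_of_ae (ae_ne a),
        ae_restrict_mem measurableSet_Ici] with x e1 e2 e3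
      have : x ∉ Iic a := fun h => e2 (le_antisymm h e3)
      rw [e1]
      simp [indicator_of_notMem this]
    · have lk := locallyIntegrable_of_memLp m2
      have lφ := locallyIntegrable_of_memLp m1
      have K' : IsSol (pot V z) (k - z • φ) univ φ w := K.congr_coeff (.of_forall fun t => by
        simp [pot]
        ring)
      have D := K'.sub H (locallyIntegrable_pot hV z) (lk.sub (lφ.smul z))
        (locallyIntegrable_of_memLp (memLp_coeFn_L2 _))
      have he : e - (u a, v a) = ((φ - u) a, (w - v) a) := by
        refine Prod.ext ?_ ?_ <;> simp [h1, h2]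
      rw [he]
      refine mem_weylSpace_of_isSol hV self_mem_Iic (D.mono (subset_univ _)) ?_
        ((m1.sub mu).restrict _)
      filter_upwards [ae_restrict_of_ae (hGe z), ae_restrict_mem measurableSet_Iic] with x e1 e2
      rw [Pi.sub_apply, e1]
      simp [indicator_of_mem e2]

theorem weylSpace_Ici_exists (hV : LocallyIntegrable V) {z : ℂ} (hz : z.im ≠ 0) (a : ℝ) :
    ∃ y ∈ weylSpace hV z (Ici a) a, y.1 ≠ 0 := by
  obtain ⟨u, v, H, hu, m⟩ := exists_weyl_sol_Ici hV hz a
  exact ⟨(u a, v a), ⟨u, v, H, rfl, rfl, m⟩, hu⟩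

theorem weylSpace_Iic_exists (hV : LocallyIntegrable V) {z : ℂ} (hz : z.im ≠ 0) (a : ℝ) :
    ∃ y ∈ weylSpace hV z (Iic a) a, y.1 ≠ 0 := by
  obtain ⟨u, v, H, hu, m⟩ := exists_weyl_sol_Iic hV hz a
  exact ⟨(u a, v a), ⟨u, v, H, rfl, rfl, m⟩, hu⟩

theorem ne_bot_of_exists_fst_ne_zero {D : Submodule ℂ (ℂ × ℂ)} (h : ∃ y ∈ D, y.1 ≠ 0) :
    D ≠ ⊥ := by
  rintro rfl
  obtain ⟨y, hy, h0⟩ := h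
  rw [Submodule.mem_bot] at hy
  simp [hy] at h0

/-- The analytic projection has trace `1`, so that neither it nor its complement vanishes. -/
theorem exists_analytic_data (hV : LocallyIntegrable V) {z₀ : ℂ}
    (hz : z₀ ∈ rho (hamiltonian V)) (a : ℝ) :
    (∃ p : ℂ → ℂ × ℂ, AnalyticAt ℂ p z₀ ∧ p z₀ ≠ 0 ∧
      ∀ᶠ z in 𝓝 z₀, p z ∈ weylSpace hV z (Ici a) a) ∧
    ∃ p : ℂ → ℂ × ℂ, AnalyticAt ℂ p z₀ ∧ p z₀ ≠ 0 ∧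
      ∀ᶠ z in 𝓝 z₀, p z ∈ weylSpace hV z (Iic a) a := by
  obtain ⟨p, hpa, hp⟩ := exists_analytic_projection hV hz a (1, 0)
  obtain ⟨r, hra, hr⟩ := exists_analytic_projection hV hz a (0, 1)
  -- The columns of the projection P are p and r. At non-real z, det P = 0 and det(1 - P) = 0
  -- because both ranges are lines; subtracting the two equations gives trace P = 1. With trace 1,
  -- not both columns of P vanish at z₀, and likewise for 1 - P.
  have htr : (p z₀).1 + (r z₀).2 = 1 := by
    have hc : Tendsto (fun z => (p z).1 + (r z).2) (𝓝[≠] z₀) (𝓝 ((p z₀).1 + (r z₀).2)) :=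
      ((continuous_fst.continuousAt.comp hpa.continuousAt).add
        (continuous_snd.continuousAt.comp hra.continuousAt)).tendsto.mono_left nhdsWithin_le_nhds
    refine tendsto_nhds_unique_of_frequently_eq hc tendsto_const_nhds
      ((frequently_im_ne_zero z₀).mp ?_)
    filter_upwards [hp.filter_mono nhdsWithin_le_nhds, hr.filter_mono nhdsWithin_le_nhds]
      with z h1 h2 him
    have hd := disjoint_weylSpace hV h1.1 a
    have d1 := det₂_eq_zero_of_disjoint hd
      (ne_bot_of_exists_fst_ne_zero (weylSpace_Iic_exists hV him a)) h1.2.1 h2.2.1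
    have d2 := det₂_eq_zero_of_disjoint hd.symm
      (ne_bot_of_exists_fst_ne_zero (weylSpace_Ici_exists hV him a)) h1.2.2 h2.2.2
    simp only [det₂, Prod.fst_sub, Prod.snd_sub] at d1 d2
    linear_combination d1 - d2
  constructor
  · by_cases h : p z₀ = 0
    · refine ⟨r, hra, fun h' => ?_, hr.mono fun z hz => hz.2.1⟩
      rw [h, h'] at htr
      simp at htr
    · exact ⟨p, hpa, h, hp.mono fun z hz => hz.2.1⟩
  · by_cases h : ((1, 0) : ℂ × ℂ) - p z₀ = 0
    · refine ⟨fun z => (0, 1) - r z, analyticAt_const.sub hra, fun h' => ?_,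
        hr.mono fun z hz => hz.2.2⟩
      rw [sub_eq_zero] at h h'
      rw [← h, ← h'] at htr
      norm_num at htr
    · exact ⟨fun z => (1, 0) - p z, analyticAt_const.sub hpa, h, hp.mono fun z hz => hz.2.2⟩

theorem weylSpace_ne_bot (hV : LocallyIntegrable V) {z : ℂ}
    (hz : z ∈ rho (hamiltonian V)) (a : ℝ) :
    weylSpace hV z (Ici a) a ≠ ⊥ ∧ weylSpace hV z (Iic a) a ≠ ⊥ := by
  obtain ⟨⟨p, -, h1, h2⟩, ⟨r, -, h3, h4⟩⟩ := exists_analytic_data hV hz a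
  exact ⟨(Submodule.ne_bot_iff _).2 ⟨_, h2.self_of_nhds, h1⟩,
    (Submodule.ne_bot_iff _).2 ⟨_, h4.self_of_nhds, h3⟩⟩

theorem eventually_mem_rho {z₀ : ℂ} (hz : z₀ ∈ rho (hamiltonian V)) :
    ∀ᶠ z in 𝓝 z₀, z ∈ rho (hamiltonian V) := by
  obtain ⟨R₀, hR₀⟩ := hz
  obtain ⟨R, -, hR⟩ := hR₀.exists_analyticAt
  exact hR.mono fun z h => ⟨R z, h⟩

end WeylSpace

/-! ### The Weyl–Titchmarsh coefficient as the slope of the data line -/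

section WeylCoefficient

theorem weylCoeff_spec {V : ℝ → ℝ} {S : Set ℝ} {a : ℝ} {z σ : ℂ}
    (hex : ∃ m, IsWeylCoeff V S a σ z m) :
    IsWeylCoeff V S a σ z (weylCoeff V S a σ z) := by
  rw [weylCoeff, dif_pos hex]
  exact hex.choose_spec

variable {V : ℝ → ℝ} {z z₀ σ : ℂ} {u v h : ℝ → ℂ} {S : Set ℝ} [hSo : S.OrdConnected] {a : ℝ}

theorem isEigenSol_of_isSol (hV : LocallyIntegrable V) (hS : UniqueDiffOn ℝ S)
    (H : IsSol (pot V z) 0 S u v) : IsEigenSol V S z u := by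
  refine ⟨H.reg hS (locallyIntegrable_pot hV z) locallyIntegrable_zero, ?_⟩
  filter_upwards [H.diffExpr_ae_eq hS hV locallyIntegrable_zero] with x hx
  rw [hx]
  simp

theorem IsEigenSol.isSol (H : IsEigenSol V S z u) : IsSol (pot V z) 0 S u (derivWithin u S) := by
  refine H.1.isSol ?_
  filter_upwards [H.2] with x hx
  rw [hx]
  simp

/-- The function c + σms is the solution with data (1, σm) at a. -/
theorem isWeylCoeff_iff (hV : LocallyIntegrable V) (hS : UniqueDiffOn ℝ S) (ha : a ∈ S) {m : ℂ} :
    IsWeylCoeff V S a σ z m ↔ ((1, σ * m) : ℂ × ℂ) ∈ weylSpace hV z S a := by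
  have hq := locallyIntegrable_pot hV z
  have h0 : LocallyIntegrable (0 : ℝ → ℂ) := locallyIntegrable_zero
  constructor
  · rintro ⟨c, s, hc, hs, c1, c2, s1, s2, hm⟩
    have := hc.isSol.add (hs.isSol.smul (σ * m)) hq h0 (h0.smul _)
    rw [smul_zero, add_zero] at this
    have := mem_weylSpace_of_isSol hV ha this (.of_forall fun _ => rfl) hm
    simpa [c1, c2, s1, s2] using this
  · rintro ⟨u, v, H, e1, e2, hm⟩
    obtain ⟨c, c', hc, hc1, hc2⟩ := exists_isSol hq h0 a (1, 0)
    obtain ⟨s, s', hs, hs1, hs2⟩ := exists_isSol hq h0 a (0, 1)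
    have hc' := hc.mono (subset_univ S)
    have hs' := hs.mono (subset_univ S)
    refine ⟨c, s, isEigenSol_of_isSol hV hS hc', isEigenSol_of_isSol hV hS hs', hc1,
      ((hc'.derivWithin hS hq h0) a ha).2.trans hc2, hs1,
      ((hs'.derivWithin hS hq h0) a ha).2.trans hs2, ?_⟩
    have := hc.add (hs.smul (σ * m)) hq h0 (h0.smul _)
    rw [smul_zero, add_zero] at this
    have e := fun x => (H.unique hq h0 this (mem_univ a) (by simp [e1, hc1, hs1])
      (by simp [e2, hc2, hs2]) x trivial).1
    rwa [funext e] at hm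

/-- The data space is a line not contained in u = 0, so its slope, and with it m, is unique and the
choice in `weylCoeff` is immaterial. The value is σp₂/p₁; in reciprocal form it stays correct for p₂
= 0, since 0⁻¹ = 0. -/
theorem weylCoeff_eq (hV : LocallyIntegrable V) (hS : UniqueDiffOn ℝ S) (ha : a ∈ S)
    (hσ : σ * σ = 1) {p : ℂ × ℂ} (hp : p ∈ weylSpace hV z S a) (hp0 : p.1 ≠ 0)
    (hdet : ∀ x ∈ weylSpace hV z S a, ∀ y ∈ weylSpace hV z S a, det₂ x y = 0) :
    weylCoeff V S a σ z = (σ * (p.1 / p.2))⁻¹ := by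
  have hex : ∃ m, IsWeylCoeff V S a σ z m := by
    refine ⟨σ * (p.2 / p.1), (isWeylCoeff_iff hV hS ha).2 ?_⟩
    rw [← mul_assoc, hσ, one_mul]
    have : ((1, p.2 / p.1) : ℂ × ℂ) = p.1⁻¹ • p := by
      refine Prod.ext ?_ ?_
      · simp [hp0]
      · simp [div_eq_inv_mul]
    rw [this]
    exact Submodule.smul_mem _ _ hp
  have h1 := (isWeylCoeff_iff hV hS ha).1 (weylCoeff_spec hex)
  have h2 := hdet _ hp _ h1
  simp only [det₂, mul_one] at h2
  have hσ' : σ⁻¹ = σ := inv_eq_of_mul_eq_one_left hσ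
  rw [mul_inv, inv_div, hσ', eq_comm, mul_div_assoc', div_eq_iff hp0]
  linear_combination σ * -h2 + weylCoeff V S a σ z * p.1 * hσ

/-- The boundary condition with the Weyl-Titchmarsh coefficient describes the data of the square
integrable solutions. -/
theorem weylBC_iff (hV : LocallyIntegrable V) (hS : UniqueDiffOn ℝ S) (ha : a ∈ S)
    (hσ : σ * σ = 1) {p : ℂ → ℂ × ℂ} (hpa : AnalyticAt ℂ p z₀) (hp0 : p z₀ ≠ 0)
    (hp : ∀ᶠ z in 𝓝 z₀, p z ∈ weylSpace hV z S a)
    (hdet : ∀ᶠ z in 𝓝 z₀, ∀ x ∈ weylSpace hV z S a, ∀ y ∈ weylSpace hV z S a, det₂ x y = 0)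
    (hex : ∀ z : ℂ, z.im ≠ 0 → ∃ y ∈ weylSpace hV z S a, y.1 ≠ 0) (α β : ℂ) :
    WeylBC (weylCoeff V S a σ) σ z₀ α β ↔ (α, β) ∈ weylSpace hV z₀ S a := by
  have hσ0 : σ ≠ 0 := left_ne_zero_of_mul_eq_one hσ
  have hσ' : σ⁻¹ = σ := inv_eq_of_mul_eq_one_left hσ
  have ha1 : AnalyticAt ℂ (fun z => (p z).1) z₀ := analyticAt_fst.comp hpa
  have ha2 : AnalyticAt ℂ (fun z => (p z).2) z₀ := analyticAt_snd.comp hpa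
  -- `M` is the candidate extension. As the inverse of `f`, which is analytic when p₂(z₀) ≠ 0, it is
  -- in normal form also at a pole; when p₁(z₀) ≠ 0 it is analytic itself.
  let f : ℂ → ℂ := fun z => σ * ((p z).1 / (p z).2)
  let M : ℂ → ℂ := f⁻¹
  have hpne : ∀ᶠ z in 𝓝 z₀, p z ≠ 0 := hpa.continuousAt.eventually_ne hp0
  have hp1 : ∀ᶠ z in 𝓝 z₀, z.im ≠ 0 → (p z).1 ≠ 0 := by
    filter_upwards [hpne, hp, hdet] with z h1 h2 h3 him h0
    obtain ⟨y, hy, hy0⟩ := hex z him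
    obtain ⟨c, hc⟩ := smul_eq_of_det₂_eq_zero h1 (h3 _ h2 _ hy)
    apply hy0
    rw [hc]
    simp [h0]
  have hMext : ∀ᶠ z in 𝓝 z₀, z.im ≠ 0 → M z = weylCoeff V S a σ z := by
    filter_upwards [hp1, hp, hdet] with z h1 h2 h3 him
    exact (weylCoeff_eq hV hS ha hσ h2 (h1 him) h3).symm
  have hMeq : ∀ z, M z = σ * ((p z).2 / (p z).1) := fun z => by
    simp only [M, f, Pi.inv_apply]
    rw [mul_inv, inv_div, hσ']
  have hMan : (p z₀).1 ≠ 0 → AnalyticAt ℂ M z₀ := fun h => by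
    have : M = fun z => σ * ((p z).2 / (p z).1) := funext hMeq
    rw [this]
    exact analyticAt_const.mul (ha2.div ha1 h)
  have hfan : (p z₀).2 ≠ 0 → AnalyticAt ℂ f z₀ := fun h => analyticAt_const.mul (ha1.div ha2 h)
  have hMnf : MeromorphicNFAt M z₀ := by
    by_cases h : (p z₀).1 = 0
    · have h2 : (p z₀).2 ≠ 0 := fun h2 => hp0 (Prod.ext h h2)
      exact (hfan h2).meromorphicNFAt.inv
    · exact (hMan h).meromorphicNFAt
  have hMord : 0 ≤ meromorphicOrderAt M z₀ ↔ (p z₀).1 ≠ 0 := by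
    rw [hMnf.meromorphicOrderAt_nonneg_iff_analyticAt]
    refine ⟨fun hM h => ?_, hMan⟩
    have h2 : (p z₀).2 ≠ 0 := fun h2 => hp0 (Prod.ext h h2)
    have hc : Tendsto (fun z => f z * M z) (𝓝[≠] z₀) (𝓝 (f z₀ * M z₀)) :=
      ((hfan h2).continuousAt.mul hM.continuousAt).tendsto.mono_left nhdsWithin_le_nhds
    -- If `M` were analytic where p₁ vanishes, then f·M = 1 off the real axis would persist at z₀,
    -- although f(z₀) = 0.
    have : f z₀ * M z₀ = 1 := by
      refine tendsto_nhds_unique_of_frequently_eq hc tendsto_const_nhds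
        ((frequently_im_ne_zero z₀).mp ?_)
      have h2' := ha2.continuousAt.eventually_ne h2
      filter_upwards [hp1.filter_mono nhdsWithin_le_nhds, h2'.filter_mono nhdsWithin_le_nhds]
        with z h3 h4 him
      exact mul_inv_cancel₀ (mul_ne_zero hσ0 (div_ne_zero (h3 him) h4))
    simp [f, h] at this
  have hdetiff : det₂ (p z₀) (α, β) = 0 ↔ (α, β) ∈ weylSpace hV z₀ S a := by
    refine ⟨fun h => ?_, fun h => hdet.self_of_nhds _ hp.self_of_nhds _ h⟩
    obtain ⟨c, hc⟩ := smul_eq_of_det₂_eq_zero hp0 h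
    rw [hc]
    exact Submodule.smul_mem _ _ hp.self_of_nhds
  have hBC : ((0 ≤ meromorphicOrderAt M z₀ → β - σ * M z₀ * α = 0) ∧
      (meromorphicOrderAt M z₀ < 0 → α = 0)) ↔ det₂ (p z₀) (α, β) = 0 := by
    rw [← not_le, hMord, not_not, hMeq]
    by_cases h : (p z₀).1 = 0
    · have h2 : (p z₀).2 ≠ 0 := fun h2 => hp0 (Prod.ext h h2)
      simp [h, det₂, h2]
    · simp only [h, det₂, ne_eq, not_false_eq_true, true_imp_iff, false_imp_iff, and_true]
      have e : β - σ * (σ * ((p z₀).2 / (p z₀).1)) * α =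
          ((p z₀).1 * β - (p z₀).2 * α) / (p z₀).1 := by
        rw [← mul_assoc, hσ, one_mul]
        field_simp
      rw [e, div_eq_zero_iff, or_iff_left h]
  rw [← hdetiff, ← hBC]
  constructor
  · rintro ⟨N, ⟨hNnf, hN⟩, hb⟩
    -- Two extensions agree at non-real points accumulating at z₀, hence on a punctured
    -- neighbourhood by the identity theorem; the normal form then settles z₀ itself.
    have hNM : N =ᶠ[𝓝 z₀] M := by
      rw [← hNnf.eventuallyEq_nhdsNE_iff_eventuallyEq_nhds hMnf,
        ← hNnf.meromorphicAt.frequently_eq_iff_eventuallyEq hMnf.meromorphicAt]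
      refine (frequently_im_ne_zero z₀).mp ?_
      filter_upwards [hN.filter_mono nhdsWithin_le_nhds, hMext.filter_mono nhdsWithin_le_nhds]
        with z h1 h2 him
      rw [h1 him, h2 him]
    rwa [meromorphicOrderAt_congr (hNM.filter_mono nhdsWithin_le_nhds), hNM.eq_of_nhds] at hb
  · exact fun hb => ⟨M, ⟨hMnf, hMext⟩, hb⟩

end WeylCoefficient

/-! ### Boundary conditions at the two endpoints -/

section BoundaryConditions

variable {V : ℝ → ℝ} {z : ℂ}

theorem weylBC_plus_iff (hV : LocallyIntegrable V) (hz : z ∈ rho (hamiltonian V)) (a : ℝ)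
    (α β : ℂ) : WeylBC (weylPlus V a) 1 z α β ↔ (α, β) ∈ weylSpace hV z (Ici a) a := by
  obtain ⟨⟨p, h1, h2, h3⟩, -⟩ := exists_analytic_data hV hz a
  refine weylBC_iff hV (uniqueDiffOn_Ici a) self_mem_Ici (one_mul 1) h1 h2 h3 ?_
    (fun z hz => weylSpace_Ici_exists hV hz a) α β
  filter_upwards [eventually_mem_rho hz] with z hz x hx y hy
  exact det₂_eq_zero_of_disjoint (disjoint_weylSpace hV hz a) (weylSpace_ne_bot hV hz a).2 hx hy

theorem weylBC_minus_iff (hV : LocallyIntegrable V) (hz : z ∈ rho (hamiltonian V)) (a : ℝ)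
    (α β : ℂ) : WeylBC (weylMinus V a) (-1) z α β ↔ (α, β) ∈ weylSpace hV z (Iic a) a := by
  obtain ⟨-, ⟨p, h1, h2, h3⟩⟩ := exists_analytic_data hV hz a
  refine weylBC_iff hV (uniqueDiffOn_Iic a) self_mem_Iic (by norm_num) h1 h2 h3 ?_
    (fun z hz => weylSpace_Iic_exists hV hz a) α β
  filter_upwards [eventually_mem_rho hz] with z hz x hx y hy
  exact det₂_eq_zero_of_disjoint (disjoint_weylSpace hV hz a).symm (weylSpace_ne_bot hV hz a).1
    hx hy

end BoundaryConditions

/-! ### The boundary value problem on I and the resolvent -/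

section Transparent

variable {V : ℝ → ℝ} {z : ℂ} {am ap : ℝ}

theorem resolventOp_spec {E : Type*} [NormedAddCommGroup E] [NormedSpace ℂ E]
    {T : E →ₗ.[ℂ] E} {z : ℂ} (hz : z ∈ rho T) : IsResolventAt T z (resolventOp T z) := by
  have hz' : ∃ R : E →L[ℂ] E, IsResolventAt T z R := hz
  rw [resolventOp, dif_pos hz']
  exact hz'.choose_spec

theorem coeFn_restrictTo (S : Set ℝ) (f : L2 univ) :
    ∀ᵐ x ∂volume.restrict S, restrictTo S f x = f x :=
  MemLp.coeFn_toLp _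

theorem coeFn_zeroExt (S : Set ℝ) [S.OrdConnected] (g : L2 S) :
    ∀ᵐ x, zeroExt S g x = S.indicator g x :=
  ae_restrict_univ.1 (MemLp.coeFn_toLp (memLp_indicator S g))

theorem coeFn_zeroExt_eq (S : Set ℝ) [hS : S.OrdConnected] (g : L2 S) :
    ∀ᵐ x ∂volume.restrict S, zeroExt S g x = g x := by
  filter_upwards [ae_restrict_of_ae (coeFn_zeroExt S g), ae_restrict_mem hS.measurableSet]
    with x h1 h2
  rw [h1, indicator_of_mem h2]

theorem coeFn_zeroExt_Iic (am ap : ℝ) (g : L2 (Icc am ap)) :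
    ∀ᵐ x ∂volume.restrict (Iic am), zeroExt (Icc am ap) g x = 0 := by
  filter_upwards [ae_restrict_of_ae (coeFn_zeroExt (Icc am ap) g), ae_restrict_mem measurableSet_Iic,
    ae_restrict_of_ae (ae_ne am)] with x h1 h2 h3
  have : x ∉ Icc am ap := fun h => h3 (le_antisymm h2 h.1)
  rw [h1, indicator_of_notMem this]

theorem coeFn_zeroExt_Ici (am ap : ℝ) (g : L2 (Icc am ap)) :
    ∀ᵐ x ∂volume.restrict (Ici ap), zeroExt (Icc am ap) g x = 0 := by
  filter_upwards [ae_restrict_of_ae (coeFn_zeroExt (Icc am ap) g), ae_restrict_mem measurableSet_Ici,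
    ae_restrict_of_ae (ae_ne ap)] with x h1 h2 h3
  have : x ∉ Icc am ap := fun h => h3 (le_antisymm h.2 h2)
  rw [h1, indicator_of_notMem this]

/-- The restriction of the resolvent solves the boundary value problem. -/
theorem isTBCSolution_restrictTo (hV : LocallyIntegrable V) (hI : am < ap)
    (hz : z ∈ rho (hamiltonian V)) (g : L2 (Icc am ap)) :
    IsTBCSolution V am ap z g
      (restrictTo (Icc am ap) (resolventOp (hamiltonian V) z (zeroExt (Icc am ap) g))) := by
  have hq := locallyIntegrable_pot hV z
  have hR := resolventOp_spec hz
  obtain ⟨u, v, hu, H⟩ := hR.exists_isSol (zeroExt (Icc am ap) g)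
  have hl := locallyIntegrable_of_memLp (memLp_coeFn_L2 (zeroExt (Icc am ap) g))
  have mu : MemLp u 2 volume := (memLp_congr_ae hu).1 (memLp_coeFn_L2 _)
  have HI := H.mono (subset_univ (Icc am ap))
  have hUD := uniqueDiffOn_Icc hI
  refine ⟨u, ?_, HI.reg hUD hq hl, ?_, ?_, ?_⟩
  · filter_upwards [coeFn_restrictTo (Icc am ap) (resolventOp (hamiltonian V) z
      (zeroExt (Icc am ap) g)), ae_restrict_of_ae hu] with x h1 h2
    rw [h1, h2]
  · filter_upwards [HI.diffExpr_ae_eq hUD hV hl, coeFn_zeroExt_eq (Icc am ap) g] with x h1 h2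
    rw [h1, h2]
    ring
  · rw [weylBC_minus_iff hV hz, (HI.derivWithin hUD hq hl am (left_mem_Icc.2 hI.le)).2]
    exact mem_weylSpace_of_isSol hV self_mem_Iic (H.mono (subset_univ _))
      (coeFn_zeroExt_Iic am ap g) (mu.restrict _)
  · rw [weylBC_plus_iff hV hz, (HI.derivWithin hUD hq hl ap (right_mem_Icc.2 hI.le)).2]
    exact mem_weylSpace_of_isSol hV self_mem_Ici (H.mono (subset_univ _))
      (coeFn_zeroExt_Ici am ap g) (mu.restrict _)

theorem memLp_of_mem_weylSpace (hV : LocallyIntegrable V) {S : Set ℝ} [hS : S.OrdConnected]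
    {a : ℝ} (ha : a ∈ S) {u v h : ℝ → ℂ} (H : IsSol (pot V z) h S u v)
    (h0 : ∀ᵐ x ∂volume.restrict S, h x = 0) (hm : (u a, v a) ∈ weylSpace hV z S a) :
    MemLp u 2 (volume.restrict S) := by
  obtain ⟨u', v', H', e1, e2, m⟩ := hm
  have H0 : IsSol (pot V z) 0 S u v := H.congr_source (by
    filter_upwards [h0] with x hx
    rw [hx]
    rfl)
  have e := H0.unique (locallyIntegrable_pot hV z) locallyIntegrable_zero
    (H'.mono (subset_univ S)) ha e1.symm e2.symm
  refine (memLp_congr_ae ?_).1 m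
  filter_upwards [ae_restrict_mem hS.measurableSet] with x hx using (e x hx).1.symm

/-- The solution of the boundary value problem is the restriction of the resolvent. -/
theorem IsTBCSolution.eq_restrictTo (hV : LocallyIntegrable V) (hI : am < ap)
    (hz : z ∈ rho (hamiltonian V)) {g φ : L2 (Icc am ap)} (h : IsTBCSolution V am ap z g φ) :
    φ = restrictTo (Icc am ap) (resolventOp (hamiltonian V) z (zeroExt (Icc am ap) g)) := by
  have hq := locallyIntegrable_pot hV z
  have hR := resolventOp_spec hz
  have hl := locallyIntegrable_of_memLp (memLp_coeFn_L2 (zeroExt (Icc am ap) g))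
  obtain ⟨w, hφ, hreg, hode, hm, hp⟩ := h
  rw [weylBC_minus_iff hV hz] at hm
  rw [weylBC_plus_iff hV hz] at hp
  have K : IsSol (pot V z) (zeroExt (Icc am ap) g) (Icc am ap) w (derivWithin w (Icc am ap)) := by
    refine hreg.isSol ?_
    filter_upwards [hode, coeFn_zeroExt_eq (Icc am ap) g] with x h1 h2
    rw [h2, ← h1]
    ring
  have hma := left_mem_Icc.2 hI.le
  have hpa := right_mem_Icc.2 hI.le
  -- The solution is continued to the line with the source extended by zero. The boundary conditions
  -- make both tails square integrable, so the continuation is the resolvent's value.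
  obtain ⟨u, v, H, -, -, e⟩ := K.extend hq hl hma
  rw [(e am hma).1, (e am hma).2] at hm
  rw [(e ap hpa).1, (e ap hpa).2] at hp
  have m1 := memLp_of_mem_weylSpace hV self_mem_Iic (H.mono (subset_univ _))
    (coeFn_zeroExt_Iic am ap g) hm
  have m2 := memLp_of_mem_weylSpace hV self_mem_Ici (H.mono (subset_univ _))
    (coeFn_zeroExt_Ici am ap g) hp
  have hu : Continuous u := continuousOn_univ.1 H.cont_u
  have m3 : MemLp u 2 (volume.restrict (Icc am ap)) := by
    rw [← memLp_indicator_iff_restrict measurableSet_Icc]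
    exact memLp_indicator_of_continuous hu am ap
  have m4 : MemLp u 2 (volume.restrict (Ici am)) := by
    refine memLp_of_sq_integrableOn hu ?_
    rw [← Icc_union_Ici_eq_Ici hI.le]
    exact IntegrableOn.union ((memLp_two_iff_integrable_sq_norm hu.aestronglyMeasurable).1 m3)
      ((memLp_two_iff_integrable_sq_norm hu.aestronglyMeasurable).1 m2)
  have mu : MemLp u 2 volume := memLp_of_Iic_of_Ici m1 m4
  have hψ := hR.eq_of_isSol hV H (coeFn_toL2 mu) (g := zeroExt (Icc am ap) g)
    (.of_forall fun _ => rfl)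
  rw [hψ]
  refine Lp.ext ?_
  filter_upwards [hφ, coeFn_restrictTo (Icc am ap) (toL2 u mu), ae_restrict_of_ae (coeFn_toL2 mu),
    ae_restrict_mem measurableSet_Icc] with x h1 h2 h3 h4
  rw [h1, h2, h3, (e x h4).1]

/-- Removing the part of f on S leaves a function vanishing on S, which is orthogonal to everything
supported in S. -/
theorem zeroExt_restrictTo (S : Set ℝ) [hS : S.OrdConnected] (f : L2 univ) :
    zeroExt S (restrictTo S f) = (L2Sub S).starProjection f := by
  have hmem : zeroExt S (restrictTo S f) ∈ L2Sub S := LinearMap.mem_range_self _ _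
  refine (Submodule.eq_starProjection_of_mem_of_inner_eq_zero hmem ?_).symm
  rintro _ ⟨g, rfl⟩
  change inner ℂ (f - zeroExt S (restrictTo S f)) (zeroExt S g) = 0
  rw [L2.inner_def, ← integral_zero ℝ ℂ (μ := volume.restrict univ)]
  refine integral_congr_ae (ae_restrict_univ.2 ?_)
  filter_upwards [coeFn_zeroExt S g, coeFn_zeroExt S (restrictTo S f),
    coeFn_sub_L2 f (zeroExt S (restrictTo S f)),
    (ae_restrict_iff' hS.measurableSet).1 (coeFn_restrictTo S f)] with x h1 h2 h3 h4
  rw [h3, h1, h2]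
  by_cases hx : x ∈ S
  · simp [hx, h4 hx]
  · simp [hx]

end Transparent

end Schrodinger

theorem mainTheorem3 (V : ℝ → ℝ) (hV : MeasureTheory.LocallyIntegrable V)
    (am ap : ℝ) (hI : am < ap)
    (hminus : Schrodinger.LimitPoint V (Set.Iic am))
    (hplus : Schrodinger.LimitPoint V (Set.Ici ap))
    (z : ℂ) (hz : z ∈ Schrodinger.rho (Schrodinger.hamiltonian V))
    (g : Schrodinger.L2 (Set.Icc am ap)) :
    let ψ : Schrodinger.L2 Set.univ :=
      Schrodinger.resolventOp (Schrodinger.hamiltonian V) z (Schrodinger.zeroExt (Set.Icc am ap) g)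
    let φ : Schrodinger.L2 (Set.Icc am ap) := Schrodinger.restrictTo (Set.Icc am ap) ψ
    Schrodinger.IsTBCSolution V am ap z g φ ∧
      (∀ φ' : Schrodinger.L2 (Set.Icc am ap),
        Schrodinger.IsTBCSolution V am ap z g φ' → φ' = φ) ∧
      Schrodinger.zeroExt (Set.Icc am ap) φ =
        (Schrodinger.L2Sub (Set.Icc am ap)).starProjection ψ :=
  ⟨Schrodinger.isTBCSolution_restrictTo hV hI hz g,
    fun _ h => h.eq_restrictTo hV hI hz,
    Schrodinger.zeroExt_restrictTo _ _⟩
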